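/- Let $n_r,n_t\ge 1$. There is a nonzero polynomial $q$ in the entries of an $n_r\times n_t$ complex matrix such that the following holds for every $H\in\mathbb{C}^{n_r\times n_t}$ with $q(H)\ne 0$ (that is, for generic $H$). Let $\Theta_R$ be a random vector with values in $[0,2\pi)^{n_r}$ (receive phase noise) whose differential entropy satisfies $h(\Theta_R)>-\infty$, and let $\Theta_T$ be a random vector in $\mathbb{R}^{n_t}$ (transmit phase noise), possibly zero and possibly dependent on $\Theta_R$. Then there is a constant $c_H\in\mathbb{R}$, which may depend on $H$ and on the phase noise but not on $P$, such that for every $P>0$ the following is true. If $X\sim\mathcal{CN}(0,\frac{P}{n_t}I_{n_t})$ and $Z\sim\mathcal{CN}(0,I_{n_r})$, and $X$, $Z$ and the pair $(\Theta_R,\Theta_T)$ are independent, then the output $$Y=\Big(H\circ\big[e^{j(\Theta_{R,i}+\Theta_{T,k})}\big]_{i,k}\Big)X+Z\in\mathbb{C}^{n_r}$$ satisfies $$h(Y)\ \ge\ \Big(\frac{n_r}{2}+\frac12\min\{n_r,\,2n_t-1\}\Big)\log^+P+c_H .$$ Here $\circ$ is the entrywise product, logarithms are to base $2$, $\log^+P=\max\{\log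 P,0\}$, and $h$ is differential entropy in bits with respect to Lebesgue measure ($-\infty$ if there is no density). -/

import Mathlib

open MeasureTheory ProbabilityTheory
open scoped NNReal ENNReal Matrix

noncomputable section

/-- The integrand `- p log₂ p` of the differential entropy, where `p` is the Lebesgue density
of `μ`. -/
def entropyIntegrand {E : Type*} [MeasureSpace E] (μ : Measure E) (x : E) : ℝ :=
  Real.negMulLog (μ.rnDeriv volume x).toReal / Real.log 2

open Classical in
/-- Differential entropy, in bits, of a law `μ` with respect to Lebesgue measure:
`h = ∫ - p log₂ p`, as an extended real number (integral of the positive part minus integral of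
the negative part). It is `-∞` if `μ` has no density, and also if both parts are infinite
(`⊤ - ⊤ = ⊥` in `EReal`), so that every lower bound on it forces the integral to be defined. -/
def diffEntropy {E : Type*} [MeasureSpace E] (μ : Measure E) : EReal :=
  if μ ≪ (volume : Measure E) then
    ((∫⁻ x, ENNReal.ofReal (entropyIntegrand μ x) : ℝ≥0∞) : EReal)
      - ((∫⁻ x, ENNReal.ofReal (-entropyIntegrand μ x) : ℝ≥0∞) : EReal)
  else ⊥

/-- The circularly symmetric law `CN(0, v)` on `ℂ`: real and imaginary parts are independent
centred normal variables of variance `v / 2`. -/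
def complexGaussian (v : ℝ≥0) : Measure ℂ :=
  ((gaussianReal 0 (v / 2)).prod (gaussianReal 0 (v / 2))).map
    (fun p : ℝ × ℝ => (⟨p.1, p.2⟩ : ℂ))

/-- The law `CN(0, v I_n)` on `ℂⁿ`. -/
def complexGaussianVec (n : ℕ) (v : ℝ≥0) : Measure (Fin n → ℂ) :=
  Measure.pi fun _ => complexGaussian v

/-- Output `(H ∘ e^{jΘ}) x + z` of the phase noise channel with transmit and receive phase noise,
`Θ i k = θR i + θT k`. -/
def phaseNoiseOutput {nr nt : ℕ} (H : Matrix (Fin nr) (Fin nt) ℂ)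
    (θR : Fin nr → ℝ) (θT : Fin nt → ℝ) (x : Fin nt → ℂ) (z : Fin nr → ℂ) : Fin nr → ℂ :=
  (H ⊙ Matrix.of fun i k => Complex.exp (((θR i + θT k : ℝ) : ℂ) * Complex.I)) *ᵥ x + z

/-- `p H` holds for generic `H`: for all matrices outside some algebraic hypersurface
`{q = 0}`, `q ≠ 0`. -/
def HoldsForGeneric {m n : ℕ} (p : Matrix (Fin m) (Fin n) ℂ → Prop) : Prop :=
  ∃ q : MvPolynomial (Fin m × Fin n) ℂ, q ≠ 0 ∧
    ∀ H : Matrix (Fin m) (Fin n) ℂ, MvPolynomial.eval (fun ik => H ik.1 ik.2) q ≠ 0 → p H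

end

/-!
The lower bound on `h(Y)` rests on one inequality for mixtures. Let `W` be the noiseless output,
`φ` the noise density and `p y = E[φ (y - W)]` the output density. If `w > 0` is a weight depending
on the randomness of `W` such that `E[w * φ (y - W)] ≤ C` for every `y`, then `log t ≤ t - 1`,
applied under the posterior law given `y`, yields `E[log w | y] ≤ log C - log p y`, and averaging
over `y` gives `h(Y) ≥ E[log w] - log C` (`le_diffEntropy_map_add`). It remains to find a weight
which does not depend on `P`, has an integrable logarithm, and makes `C` of order
`P ^ (-(nr + m) / 2)`, where `m = min nr (2 * nt - 1)`. For `P < 1` nothing is needed, since `p ≤ 1`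
makes the entropy nonnegative.

The input law is invariant under phase rotations of its coordinates. So the transmit phase noise
disappears, and the output is that of the signal `exp (i θ_j) * √P * ℓ_j x`, where `ℓ_j` is the
linear form given by the `j`-th row of `H`, `θ` has the law of the receive phase noise and `x` is an
independent Gaussian vector not depending on `P` (`map_phaseNoiseOutput_eq`). The weight is built
from three factors.

* `1 / max f 1`, where `f` is the density of `θ`. It replaces `θ` by uniform phases, and it is
  log-integrable because `h(θ) > -∞`.
* `∏ j, |ℓ_j x|`. Averaging the noise density over a uniform phase of a signal of modulus `r`
  gives a factor `1 / r` and leaves a Gaussian bump in `r - |y_j|`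
  (`norm_mul_lintegral_phase_le`); this contributes `P ^ (-nr / 2)`.
* A weight making the joint law of `s_j = |ℓ_j x| ^ 2`, `j < m`, dominated by Lebesgue measure.
  Every bump, as a function of `s_j` and with the further weight `1 / (1 + s_j)`, has an integral of
  order `P ^ (-1 / 2)` (`lintegral_Ici_sqrt_le`), which contributes `P ^ (-m / 2)`.

For the last factor (`exists_weight_quadratic`), complete the `m` quadratic forms by linear
functionals to a quadratic map `G` from the space to itself, whose Jacobian determinant `J` is a
nonzero polynomial. As `G x - G x'` is the derivative of `G` at the midpoint applied to `x - x'`,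
the map `G` is injective on every ball that avoids the zeros of `J`, and on such a ball the change
of variables formula applies with weight `|J|`. A Whitney type averaging over the balls whose radius
is half the truncated distance to the zero set of `J` costs a further weight, a power of that
distance. Nonzero polynomials are log-integrable under Gaussian measures, by induction on the number
of variables and factorization over `ℂ` (`integrable_log_mvPolynomial`), and the distance to the
zero set is bounded below by `|J|` up to polynomial growth (`integrable_log_truncDist`).

That `J ≠ 0` is where `H` has to be generic: if any `nt` or fewer rows of `H` are linearly
independent, then the differentials of `m ≤ 2 * nt - 1` of the forms `|ℓ_j x| ^ 2` are independent
at some `x`. After complexification `x` and its conjugate become independent variables, and it is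
enough to choose one of them off all the hyperplanes `ℓ_j = 0`, and the other one on the hyperplanes
with `j ≥ nt` only (`FullSpark.exists_conj_mul_linearIndependent`).
-/

/-! ### Products of one-dimensional integrals and densities -/

/-- Auxiliary version of `lintegral_pi_prod` for the index type `Fin n`. -/
theorem lintegral_pi_prod_fin {n : ℕ} {E : Fin n → Type*} [∀ i, MeasurableSpace (E i)]
    (μ : (i : Fin n) → Measure (E i)) [∀ i, SigmaFinite (μ i)]
    {f : (i : Fin n) → E i → ℝ≥0∞} (hf : ∀ i, Measurable (f i)) :
    ∫⁻ x, ∏ i, f i (x i) ∂(Measure.pi μ) = ∏ i, ∫⁻ t, f i t ∂(μ i) := by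
  induction n with
  | zero => simp
  | succ n ih =>
    rw [← ((measurePreserving_piFinSuccAbove μ 0).symm).lintegral_comp_emb
      (MeasurableEquiv.measurableEmbedding _)]
    simp_rw [MeasurableEquiv.piFinSuccAbove_symm_apply, Fin.insertNthEquiv,
      Fin.prod_univ_succ, Equiv.coe_fn_mk, Fin.insertNth_zero]
    simp only [Fin.zero_succAbove, Fin.cons_zero, Fin.cons_succ]
    rw [← ih (fun i => μ (Fin.succ i)) (fun i => hf (Fin.succ i))]
    have key := lintegral_prod_mul (μ := μ 0) (ν := Measure.pi fun j : Fin n => μ (Fin.succ j))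
      (f := f 0) (g := fun x => ∏ j : Fin n, f (Fin.succ j) (x j)) (hf 0).aemeasurable
      (Finset.measurable_prod _ fun i _ =>
        (hf (Fin.succ i)).comp (measurable_pi_apply i)).aemeasurable
    exact key

theorem lintegral_pi_prod {ι : Type*} [Fintype ι] {E : ι → Type*} [∀ i, MeasurableSpace (E i)]
    (μ : (i : ι) → Measure (E i)) [∀ i, SigmaFinite (μ i)]
    {f : (i : ι) → E i → ℝ≥0∞} (hf : ∀ i, Measurable (f i)) :
    ∫⁻ x, ∏ i, f i (x i) ∂(Measure.pi μ) = ∏ i, ∫⁻ t, f i t ∂(μ i) := by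
  let e := (Fintype.equivFin ι).symm
  rw [← (measurePreserving_piCongrLeft _ e).lintegral_comp_emb
    (MeasurableEquiv.measurableEmbedding _)]
  simp_rw [← e.prod_comp, MeasurableEquiv.coe_piCongrLeft, Equiv.piCongrLeft_apply_apply]
  exact lintegral_pi_prod_fin (fun i => μ (e i)) (fun i => hf (e i))

theorem pi_withDensity {ι : Type*} [Fintype ι] {E : ι → Type*} [∀ i, MeasurableSpace (E i)]
    (μ : (i : ι) → Measure (E i)) [∀ i, SigmaFinite (μ i)]
    {f : (i : ι) → E i → ℝ≥0∞} (hf : ∀ i, Measurable (f i))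
    [∀ i, SigmaFinite ((μ i).withDensity (f i))] :
    Measure.pi (fun i => (μ i).withDensity (f i)) =
      (Measure.pi μ).withDensity fun x => ∏ i, f i (x i) := by
  refine Measure.pi_eq fun s hs => ?_
  rw [withDensity_apply _ (MeasurableSet.univ_pi hs), Measure.restrict_pi_pi,
    lintegral_pi_prod _ hf]
  exact Finset.prod_congr rfl fun i _ => (withDensity_apply _ (hs i)).symm

/-! ### Lower bounds for the entropy of a mixture -/

theorem ofReal_integral_le_lintegral_ofReal {V : Type*} [MeasurableSpace V] {μ : Measure V}
    {g h : V → ℝ} (hg : Integrable g μ) (hgh : ∀ y, g y ≤ h y) :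
    ENNReal.ofReal (∫ y, g y ∂μ) ≤ ∫⁻ y, ENNReal.ofReal (h y) ∂μ := by
  calc ENNReal.ofReal (∫ y, g y ∂μ) ≤ ENNReal.ofReal (∫ y, max (g y) 0 ∂μ) :=
        ENNReal.ofReal_le_ofReal (integral_mono hg hg.pos_part fun y => le_max_left _ _)
    _ = ∫⁻ y, ENNReal.ofReal (max (g y) 0) ∂μ :=
        ofReal_integral_eq_lintegral_ofReal hg.pos_part (.of_forall fun y => le_max_right _ _)
    _ ≤ ∫⁻ y, ENNReal.ofReal (h y) ∂μ := by
        refine lintegral_mono fun y => ?_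
        rw [ENNReal.ofReal_max, ENNReal.ofReal_zero, max_eq_left (zero_le)]
        exact ENNReal.ofReal_le_ofReal (hgh y)

section Mixture

variable {A V : Type*} [MeasurableSpace A] {η : Measure A} [IsProbabilityMeasure η]

/-- The pointwise inequality behind the entropy bound. Here `k a` is the value at a fixed output of
the density given `a`, and `p = ∫ k` is the mixture density at this output. -/
theorem mixture_log_le_negMulLog {k wt : A → ℝ} {C : ℝ} (hk : Measurable k)
    (hwt : Measurable wt) (hk0 : ∀ a, 0 ≤ k a) (hk1 : ∀ a, k a ≤ 1) (hpos : ∀ᵐ a ∂η, 0 < wt a)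
    (hlog : Integrable (fun a => Real.log (wt a)) η) (hC : 0 < C)
    (hle : ∫⁻ a, ENNReal.ofReal (wt a * k a) ∂η ≤ ENNReal.ofReal C) :
    ∫ a, k a * Real.log (wt a) ∂η - (∫ a, k a ∂η) * Real.log C ≤
      Real.negMulLog (∫ a, k a ∂η) := by
  have hkn : ∀ᵐ a ∂η, ‖k a‖ ≤ 1 := .of_forall fun a => by
    rw [Real.norm_of_nonneg (hk0 a)]; exact hk1 a
  have hki : Integrable k η := .of_bound hk.aestronglyMeasurable 1 hkn
  have hkl : Integrable (fun a => k a * Real.log (wt a)) η :=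
    hlog.bdd_mul hk.aestronglyMeasurable hkn
  have hnn : 0 ≤ᵐ[η] fun a => wt a * k a := by
    filter_upwards [hpos] with a ha using mul_nonneg ha.le (hk0 a)
  have hwk : Integrable (fun a => wt a * k a) η :=
    ⟨(hwt.mul hk).aestronglyMeasurable, by
      rw [hasFiniteIntegral_iff_ofReal hnn]; exact hle.trans_lt ENNReal.ofReal_lt_top⟩
  have hwkC : ∫ a, wt a * k a ∂η ≤ C := by
    rw [integral_eq_lintegral_of_nonneg_ae hnn hwk.1]
    exact ENNReal.toReal_le_of_le_ofReal hC.le hle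
  set p := ∫ a, k a ∂η with hp
  have hp0 : 0 ≤ p := integral_nonneg hk0
  rcases hp0.eq_or_lt with h0 | hp1
  · have : k =ᵐ[η] 0 := (integral_eq_zero_iff_of_nonneg hk0 hki).1 (hp.symm.trans h0.symm)
    have h2 : ∫ a, k a * Real.log (wt a) ∂η = 0 := by
      rw [← integral_zero A ℝ (μ := η)]
      exact integral_congr_ae (this.mono fun a ha => by simp [ha])
    simp [h2, ← h0]
  · have key : ∫ a, k a * Real.log (wt a) ∂η ≤
        ∫ a, (p / C * (wt a * k a) + (Real.log (C / p) - 1) * k a) ∂η := by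
      refine integral_mono_ae hkl ((hwk.const_mul _).add (hki.const_mul _)) ?_
      filter_upwards [hpos] with a ha
      -- `log t ≤ t - 1` is tight on average when `wt` is normalized by its posterior mean `C / p`
      have h1 : Real.log (wt a) = Real.log (wt a * p / C) + Real.log (C / p) := by
        rw [← Real.log_mul (by positivity) (by positivity)]; congr 1; field_simp
      have h2 : Real.log (wt a * p / C) ≤ wt a * p / C - 1 :=
        Real.log_le_sub_one_of_pos (by positivity)
      calc k a * Real.log (wt a) ≤ k a * (wt a * p / C - 1 + Real.log (C / p)) := by
            rw [h1]; gcongr; exact hk0 a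
        _ = _ := by ring
    rw [integral_add (hwk.const_mul _) (hki.const_mul _), integral_const_mul, integral_const_mul,
      ← hp, Real.log_div hC.ne' hp1.ne'] at key
    have h3 : p / C * ∫ a, wt a * k a ∂η ≤ p := by
      calc _ ≤ p / C * C := by gcongr
        _ = p := by field_simp
    rw [Real.negMulLog]
    linarith

/-- Integrated form of `mixture_log_le_negMulLog`: the mixture density `y ↦ ∫ K a y ∂η` has
entropy at least `∫ log wt - log C`. -/
theorem integral_log_le_lintegral_negMulLog_mixture [MeasureSpace V]
    [SigmaFinite (volume : Measure V)] {K : A → V → ℝ} {wt : A → ℝ}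
    {C : ℝ} (hK : Measurable (Function.uncurry K)) (hwt : Measurable wt)
    (hK0 : ∀ a y, 0 ≤ K a y) (hK1 : ∀ a y, K a y ≤ 1)
    (hKint : ∀ a, ∫⁻ y, ENNReal.ofReal (K a y) = 1) (hpos : ∀ᵐ a ∂η, 0 < wt a)
    (hlog : Integrable (fun a => Real.log (wt a)) η) (hC : 0 < C)
    (hle : ∀ y, ∫⁻ a, ENNReal.ofReal (wt a * K a y) ∂η ≤ ENNReal.ofReal C) :
    ENNReal.ofReal (∫ a, Real.log (wt a) ∂η - Real.log C) ≤
      ∫⁻ y, ENNReal.ofReal (Real.negMulLog (∫ a, K a y ∂η)) := by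
  have hKa : ∀ a, Integrable (K a) := fun a =>
    ⟨(hK.comp measurable_prodMk_left).aestronglyMeasurable, by
      rw [hasFiniteIntegral_iff_ofReal (.of_forall (hK0 a)), hKint]; exact ENNReal.one_lt_top⟩
  have hKa1 : ∀ a, ∫ y, K a y = 1 := fun a => by
    rw [integral_eq_lintegral_of_nonneg_ae (.of_forall (hK0 a)) (hKa a).1, hKint,
      ENNReal.toReal_one]
  have hprod : ∀ f : A → ℝ, Measurable f → Integrable f η →
      Integrable (fun z : A × V => K z.1 z.2 * f z.1) (η.prod volume) := by
    intro f hf hfi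
    have hm : Measurable fun z : A × V => K z.1 z.2 * f z.1 := hK.mul (hf.comp measurable_fst)
    rw [integrable_prod_iff hm.aestronglyMeasurable]
    refine ⟨.of_forall fun a => (hKa a).mul_const (f a), ?_⟩
    refine hfi.norm.congr (.of_forall fun a => ?_)
    simp_rw [norm_mul, Real.norm_of_nonneg (hK0 a _)]
    rw [integral_mul_const, hKa1, one_mul]
  have hswap : ∀ f : A → ℝ, Measurable f → Integrable f η →
      ∫ y, ∫ a, K a y * f a ∂η = ∫ a, f a ∂η := by
    intro f hf hfi
    rw [← integral_integral_swap (f := fun a y => K a y * f a) (hprod f hf hfi)]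
    refine integral_congr_ae (.of_forall fun a => ?_)
    simp only
    rw [integral_mul_const, hKa1, one_mul]
  have hlm : Measurable fun a => Real.log (wt a) := hwt.log
  have i1 : Integrable (fun y => ∫ a, K a y * Real.log (wt a) ∂η) :=
    (hprod _ hlm hlog).integral_prod_right
  have i2 : Integrable (fun y => ∫ a, K a y ∂η) := by
    simpa using (hprod (fun _ => 1) measurable_const (integrable_const 1)).integral_prod_right
  have e2 : ∫ y, ∫ a, K a y ∂η = 1 := by
    simpa using hswap (fun _ => 1) measurable_const (integrable_const 1)
  have hE : ∫ y, (∫ a, K a y * Real.log (wt a) ∂η - (∫ a, K a y ∂η) * Real.log C) =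
      ∫ a, Real.log (wt a) ∂η - Real.log C := by
    rw [integral_sub i1 (i2.mul_const _), hswap _ hlm hlog, integral_mul_const, e2, one_mul]
  rw [← hE]
  exact ofReal_integral_le_lintegral_ofReal (i1.sub (i2.mul_const _)) fun y =>
    mixture_log_le_negMulLog (hK.comp measurable_prodMk_right) hwt (fun a => hK0 a y)
      (fun a => hK1 a y) hpos hlog hC (hle y)

end Mixture

/-- For a density bounded by `1` the integrand `- p log p` is nonnegative, so that the differential
entropy is a plain Lebesgue integral. -/
theorem diffEntropy_withDensity {V : Type*} [MeasureSpace V] [SigmaFinite (volume : Measure V)]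
    {p : V → ℝ} (hp : Measurable p) (hp0 : ∀ y, 0 ≤ p y) (hp1 : ∀ y, p y ≤ 1) :
    diffEntropy ((volume : Measure V).withDensity fun y => ENNReal.ofReal (p y)) =
      ((∫⁻ y, ENNReal.ofReal (Real.negMulLog (p y) / Real.log 2) : ℝ≥0∞) : EReal) := by
  have hr := Measure.rnDeriv_withDensity (volume : Measure V) (hp.ennreal_ofReal)
  have h2 : 0 < Real.log 2 := Real.log_pos one_lt_two
  have e : entropyIntegrand ((volume : Measure V).withDensity fun y => ENNReal.ofReal (p y))
      =ᵐ[volume] fun y => Real.negMulLog (p y) / Real.log 2 := by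
    filter_upwards [hr] with y hy
    rw [entropyIntegrand, hy, ENNReal.toReal_ofReal (hp0 y)]
  have e0 : ∫⁻ y, ENNReal.ofReal (-entropyIntegrand
      ((volume : Measure V).withDensity fun y => ENNReal.ofReal (p y)) y) = 0 := by
    rw [← lintegral_zero]
    refine lintegral_congr_ae (e.mono fun y hy => ?_)
    simp only [hy]
    exact ENNReal.ofReal_of_nonpos (neg_nonpos.2
      (div_nonneg (Real.negMulLog_nonneg (hp0 y) (hp1 y)) h2.le))
  rw [diffEntropy, if_pos (withDensity_absolutelyContinuous _ _), e0,
    lintegral_congr_ae (e.mono fun y hy => congrArg ENNReal.ofReal hy)]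
  simp

/-- Independent noise with density `φ` added to any signal gives a law with density
`y ↦ E[φ (y - W)]`. -/
theorem map_add_eq_withDensity {A V : Type*} [MeasurableSpace A] {η : Measure A} [SFinite η]
    [AddCommGroup V] [MeasureSpace V] [MeasurableAdd₂ V] [MeasurableSub₂ V]
    [SFinite (volume : Measure V)]
    [(volume : Measure V).IsAddLeftInvariant] {W : A → V} (hW : Measurable W)
    {φ : V → ℝ≥0∞} (hφ : Measurable φ) :
    (η.prod ((volume : Measure V).withDensity φ)).map (fun q => W q.1 + q.2) =
      (volume : Measure V).withDensity fun y => ∫⁻ a, φ (y - W a) ∂η := by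
  have hm : Measurable fun q : A × V => W q.1 + q.2 := (hW.comp measurable_fst).add measurable_snd
  have hφ2 : Measurable fun q : A × V => φ (q.2 - W q.1) :=
    hφ.comp (measurable_snd.sub (hW.comp measurable_fst))
  rw [prod_withDensity_right hφ]
  ext s hs
  have hφ3 : Measurable (((fun q : A × V => W q.1 + q.2) ⁻¹' s).indicator fun q => φ q.2) :=
    (hφ.comp measurable_snd).indicator (hm hs)
  have hs2 : Measurable (s.indicator (1 : V → ℝ≥0∞)) := measurable_one.indicator hs
  rw [Measure.map_apply hm hs, withDensity_apply _ (hm hs), withDensity_apply _ hs,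
    ← lintegral_indicator (hm hs), ← lintegral_indicator hs, lintegral_prod _ hφ3.aemeasurable]
  have h1 : ∀ a, ∫⁻ z, ((fun q : A × V => W q.1 + q.2) ⁻¹' s).indicator (fun q => φ q.2) (a, z) =
      ∫⁻ y, s.indicator 1 y * φ (y - W a) := by
    intro a
    rw [← lintegral_add_left_eq_self (fun y => s.indicator 1 y * φ (y - W a)) (W a)]
    refine lintegral_congr fun z => ?_
    by_cases h : W a + z ∈ s <;> simp [Set.indicator, h]
  simp_rw [h1]
  rw [lintegral_lintegral_swap ((hs2.comp measurable_snd).mul hφ2).aemeasurable]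
  refine lintegral_congr fun y => ?_
  by_cases h : y ∈ s <;> simp [Set.indicator, h]

/-! ### Averaging Gaussian noise over a phase -/

theorem lintegral_gaussian_shift {b : ℝ} (hb : 0 < b) (c : ℝ) :
    ∫⁻ x : ℝ, ENNReal.ofReal (Real.exp (-b * (x - c) ^ 2)) = ENNReal.ofReal (√(Real.pi / b)) := by
  rw [lintegral_sub_right_eq_self (fun x => ENNReal.ofReal (Real.exp (-b * x ^ 2))) c,
    ← ofReal_integral_eq_lintegral_ofReal (integrable_exp_neg_mul_sq hb)
      (.of_forall fun x => (Real.exp_pos _).le), integral_gaussian]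

/-- Every real number is within `π / 2` of a multiple of `π`, where `|sin|` is at least
`2 / π` times the distance to that multiple. -/
theorem exists_int_mul_pi_sq_le_sin_sq (x : ℝ) :
    ∃ k : ℤ, |x - k * Real.pi| ≤ Real.pi / 2 ∧
      (2 / Real.pi * (x - k * Real.pi)) ^ 2 ≤ Real.sin x ^ 2 := by
  have hpi := Real.pi_pos
  set k := round (x / Real.pi)
  have h : |x - k * Real.pi| ≤ Real.pi / 2 := by
    have h := abs_sub_round (x / Real.pi)
    have e : x - k * Real.pi = (x / Real.pi - k) * Real.pi := by
      field_simp
    rw [e, abs_mul, abs_of_pos hpi]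
    nlinarith
  refine ⟨k, h, ?_⟩
  have h1 : 2 / Real.pi * |x - k * Real.pi| ≤ |Real.sin (x - k * Real.pi)| :=
    Real.mul_abs_le_abs_sin h
  have h2 : Real.sin (x - k * Real.pi) ^ 2 = Real.sin x ^ 2 := by
    rw [Real.sin_sub_int_mul_pi, mul_pow, ← zpow_natCast, zpow_comm]
    simp
  rw [← h2, ← sq_abs (Real.sin _), mul_pow, ← sq_abs (x - _), ← mul_pow]
  gcongr

/-- The distance from `β` to the point of phase `θ` on the orbit of `a` controls both the
radial and the angular deviation. -/
theorem sq_norm_sub_phase_mul_ge (a β : ℂ) (θ : ℝ) :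
    (‖a‖ - ‖β‖) ^ 2 / 2 + ‖a‖ ^ 2 * Real.sin (θ + a.arg - β.arg) ^ 2 / 2 ≤
      ‖β - Complex.exp (θ * Complex.I) * a‖ ^ 2 := by
  have h1 : ‖β - Complex.exp (θ * Complex.I) * a‖ ^ 2 =
      ‖a‖ ^ 2 + ‖β‖ ^ 2 - 2 * ‖a‖ * ‖β‖ * Real.cos (θ + a.arg - β.arg) := by
    rw [Complex.sq_norm, Complex.normSq_apply, Real.cos_sub, Real.cos_add, Real.sin_add]
    simp only [Complex.sub_re, Complex.sub_im, Complex.mul_re, Complex.mul_im,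
      Complex.exp_ofReal_mul_I_re, Complex.exp_ofReal_mul_I_im]
    have e1 : ‖a‖ ^ 2 = a.re ^ 2 + a.im ^ 2 := by
      rw [Complex.sq_norm, Complex.normSq_apply]; ring
    have e2 : ‖β‖ ^ 2 = β.re ^ 2 + β.im ^ 2 := by
      rw [Complex.sq_norm, Complex.normSq_apply]; ring
    have e3 := Complex.norm_mul_cos_arg a
    have e4 := Complex.norm_mul_sin_arg a
    have e5 := Complex.norm_mul_cos_arg β
    have e6 := Complex.norm_mul_sin_arg β
    have e7 := Real.sin_sq_add_cos_sq θ
    rw [e1, e2]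
    have e8 : 2 * ‖a‖ * ‖β‖ * ((Real.cos θ * Real.cos a.arg - Real.sin θ * Real.sin a.arg) *
        Real.cos β.arg + (Real.sin θ * Real.cos a.arg + Real.cos θ * Real.sin a.arg) *
        Real.sin β.arg) = 2 * ((Real.cos θ * a.re - Real.sin θ * a.im) * β.re +
        (Real.sin θ * a.re + Real.cos θ * a.im) * β.im) := by
      rw [← e3, ← e4, ← e5, ← e6]; ring
    rw [e8]
    linear_combination (a.re ^ 2 + a.im ^ 2) * e7
  rw [h1]
  set c := Real.cos (θ + a.arg - β.arg)
  have h2 : Real.sin (θ + a.arg - β.arg) ^ 2 = 1 - c ^ 2 := Real.sin_sq _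
  have h3 : c ≤ 1 := Real.cos_le_one _
  rw [h2]
  nlinarith [sq_nonneg (‖β‖ - ‖a‖ * c), mul_nonneg (mul_nonneg (norm_nonneg a) (norm_nonneg β))
    (sub_nonneg.2 h3)]

/-- The bound behind the loss of half a degree of freedom per receive antenna: smoothing a
uniformly rotated `a` by Gaussian noise gives a density of order `1 / |a|` around the circle
of radius `|a|`. -/
theorem norm_mul_lintegral_phase_le (a β : ℂ) :
    ENNReal.ofReal ‖a‖ * ∫⁻ θ in Set.Ico 0 (2 * Real.pi),
        ENNReal.ofReal (Real.exp (-‖β - Complex.exp (θ * Complex.I) * a‖ ^ 2)) ≤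
      ENNReal.ofReal (44 * Real.exp (-(‖a‖ - ‖β‖) ^ 2 / 2)) := by
  rcases eq_or_ne a 0 with rfl | ha
  · simp
  have hpi := Real.pi_pos
  have hA : 0 < ‖a‖ := norm_pos_iff.2 ha
  set b : ℝ := 2 * ‖a‖ ^ 2 / Real.pi ^ 2 with hb
  have hb0 : 0 < b := by positivity
  set E := Real.exp (-(‖a‖ - ‖β‖) ^ 2 / 2) with hE
  let c : ℤ → ℝ := fun k => k * Real.pi - a.arg + β.arg
  -- the angular part of the exponent vanishes only at the zeros of a sine, of which at most `11`
  -- are relevant; each of them contributes a Gaussian in `θ` with integral at most `4 / ‖a‖`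
  have hpt : ∀ θ ∈ Set.Ico 0 (2 * Real.pi),
      ENNReal.ofReal (Real.exp (-‖β - Complex.exp (θ * Complex.I) * a‖ ^ 2)) ≤
      ∑ k ∈ Finset.Icc (-5 : ℤ) 5, ENNReal.ofReal E *
        ENNReal.ofReal (Real.exp (-b * (θ - c k) ^ 2)) := by
    intro θ hθ
    obtain ⟨k, hk1, hk2⟩ := exists_int_mul_pi_sq_le_sin_sq (θ + a.arg - β.arg)
    have hk : k ∈ Finset.Icc (-5 : ℤ) 5 := by
      have h1 := Complex.neg_pi_lt_arg a
      have h2 := Complex.arg_le_pi a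
      have h3 := Complex.neg_pi_lt_arg β
      have h4 := Complex.arg_le_pi β
      obtain ⟨h5, h6⟩ := abs_le.1 hk1
      rw [Finset.mem_Icc]
      constructor
      · by_contra! h
        have : (k : ℝ) ≤ -6 := by exact_mod_cast (by omega : k ≤ -6)
        nlinarith [hθ.1]
      · by_contra! h
        have : (6 : ℝ) ≤ k := by exact_mod_cast (by omega : 6 ≤ k)
        nlinarith [hθ.2]
    refine le_trans ?_ (Finset.single_le_sum (f := fun k : ℤ => ENNReal.ofReal E *
      ENNReal.ofReal (Real.exp (-b * (θ - c k) ^ 2))) (fun _ _ => zero_le) hk)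
    rw [← ENNReal.ofReal_mul (Real.exp_pos _).le, ← Real.exp_add]
    refine ENNReal.ofReal_le_ofReal (Real.exp_le_exp.2 ?_)
    have h := sq_norm_sub_phase_mul_ge a β θ
    have e : b * (θ - c k) ^ 2 =
        ‖a‖ ^ 2 * (2 / Real.pi * (θ + a.arg - β.arg - k * Real.pi)) ^ 2 / 2 := by
      simp only [hb, c]; field_simp; ring
    have h' : ‖a‖ ^ 2 * (2 / Real.pi * (θ + a.arg - β.arg - k * Real.pi)) ^ 2 / 2 ≤
        ‖a‖ ^ 2 * Real.sin (θ + a.arg - β.arg) ^ 2 / 2 := by gcongr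
    linarith
  have hsq : √(Real.pi / b) ≤ 4 / ‖a‖ := by
    rw [Real.sqrt_le_left (by positivity), hb, div_pow]
    rw [div_div_eq_mul_div, div_le_div_iff₀ (by positivity) (by positivity)]
    have h3 : Real.pi < 3.15 := Real.pi_lt_d2
    have : Real.pi * Real.pi ^ 2 ≤ 32 := by
      calc Real.pi * Real.pi ^ 2 ≤ 3.15 * 3.15 ^ 2 := by gcongr
        _ ≤ 32 := by norm_num
    nlinarith [sq_nonneg ‖a‖]
  calc _ ≤ ENNReal.ofReal ‖a‖ * ∫⁻ θ : ℝ, ∑ k ∈ Finset.Icc (-5 : ℤ) 5, ENNReal.ofReal E *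
        ENNReal.ofReal (Real.exp (-b * (θ - c k) ^ 2)) := by
        refine mul_le_mul_right ?_ _
        exact (setLIntegral_mono' measurableSet_Ico hpt).trans (setLIntegral_le_lintegral _ _)
    _ = ENNReal.ofReal ‖a‖ * (11 * (ENNReal.ofReal E * ENNReal.ofReal √(Real.pi / b))) := by
        rw [lintegral_finsetSum _ fun k _ => by fun_prop]
        congr 1
        rw [Finset.sum_congr rfl fun k _ => by
          rw [lintegral_const_mul _ (by fun_prop), lintegral_gaussian_shift hb0 (c k)]]
        simp
    _ ≤ ENNReal.ofReal ‖a‖ * (11 * (ENNReal.ofReal E * ENNReal.ofReal (4 / ‖a‖))) := by gcongr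
    _ = ENNReal.ofReal (44 * E) := by
        rw [show (11 : ℝ≥0∞) = ENNReal.ofReal 11 by simp, ← ENNReal.ofReal_mul (Real.exp_pos _).le,
          ← ENNReal.ofReal_mul (by norm_num), ← ENNReal.ofReal_mul hA.le]
        congr 1
        field_simp
        rw [hE]
        ring_nf

/-- In terms of `s = r ^ 2`, a Gaussian bump of unit width in `√P * r` has mass of order
`P ^ (-1 / 2)`, uniformly in its centre, because the weight `(1 + s)⁻¹` compensates the
Jacobian `2 * r`. -/
theorem lintegral_Ici_sqrt_le {P : ℝ} (hP : 0 < P) (R : ℝ) :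
    ∫⁻ s : ℝ, (Set.Ici 0).indicator (fun s => ENNReal.ofReal
      ((1 + s)⁻¹ * Real.exp (-(√P * √s - R) ^ 2 / 2))) s ≤
        ENNReal.ofReal (√(2 * Real.pi) * P ^ (-(1 / 2 : ℝ))) := by
  have hsP : 0 < √P := Real.sqrt_pos.2 hP
  have himg : (fun r : ℝ => r ^ 2) '' Set.Ioi 0 = Set.Ioi 0 := by
    ext s
    constructor
    · rintro ⟨r, hr, rfl⟩
      exact pow_pos (Set.mem_Ioi.1 hr) 2
    · intro hs
      exact ⟨√s, Real.sqrt_pos.2 hs, Real.sq_sqrt (le_of_lt hs)⟩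
  rw [lintegral_indicator measurableSet_Ici, setLIntegral_congr Ioi_ae_eq_Ici.symm]
  nth_rewrite 1 [← himg]
  rw [lintegral_image_eq_lintegral_abs_deriv_mul measurableSet_Ioi
      (f' := fun r : ℝ => 2 * r) (fun r _ => by
        simpa using (hasDerivAt_pow 2 r).hasDerivWithinAt) (fun r hr s hs h => by
          exact (pow_left_inj₀ (le_of_lt hr) (le_of_lt hs) two_ne_zero).1 h)]
  calc _ ≤ ∫⁻ r in Set.Ioi 0, ENNReal.ofReal (Real.exp (-(P / 2) * (r - R / √P) ^ 2)) := by
        refine setLIntegral_mono' measurableSet_Ioi fun r hr => ?_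
        have hr0 : (0 : ℝ) < r := hr
        rw [← ENNReal.ofReal_mul (abs_nonneg _), Real.sqrt_sq hr0.le, abs_of_pos (by positivity)]
        apply ENNReal.ofReal_le_ofReal
        have e : -(√P * r - R) ^ 2 / 2 = -(P / 2) * (r - R / √P) ^ 2 := by
          have : √P ^ 2 = P := Real.sq_sqrt hP.le
          rw [← this]
          simp only [Real.sqrt_sq hsP.le]
          field_simp
        rw [e, ← mul_assoc]
        have : 2 * r * (1 + r ^ 2)⁻¹ ≤ 1 := by
          rw [← div_eq_mul_inv, div_le_one (by positivity)]
          nlinarith [sq_nonneg (r - 1)]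
        exact mul_le_of_le_one_left (Real.exp_pos _).le this
    _ ≤ ∫⁻ r, ENNReal.ofReal (Real.exp (-(P / 2) * (r - R / √P) ^ 2)) :=
        setLIntegral_le_lintegral _ _
    _ = ENNReal.ofReal (√(2 * Real.pi) * P ^ (-(1 / 2 : ℝ))) := by
        rw [lintegral_gaussian_shift (by positivity)]
        congr 1
        rw [Real.rpow_neg hP.le, ← Real.sqrt_eq_rpow, ← div_eq_mul_inv,
          ← Real.sqrt_div (by positivity)]
        congr 1
        field_simp

/-! ### Log-integrability of polynomials under Gaussian measures -/

/-- The negative part of `log t`, for `t ≥ 0`, with the value `∞` at `t = 0`. -/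
noncomputable def negLog (t : ℝ) : ℝ≥0∞ := if t = 0 then ⊤ else ENNReal.ofReal (-Real.log t)

@[fun_prop]
theorem measurable_negLog : Measurable negLog :=
  Measurable.ite (measurableSet_singleton 0) measurable_const (by fun_prop)

theorem negLog_mul_le (s t : ℝ) : negLog (s * t) ≤ negLog s + negLog t := by
  unfold negLog
  by_cases hs : s = 0
  · simp [hs]
  by_cases ht : t = 0
  · simp [ht]
  rw [if_neg hs, if_neg ht, if_neg (mul_ne_zero hs ht), Real.log_mul hs ht, neg_add]
  exact ENNReal.ofReal_add_le

theorem negLog_anti {s t : ℝ} (hs : 0 ≤ s) (hst : s ≤ t) : negLog t ≤ negLog s := by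
  unfold negLog
  by_cases h : s = 0
  · simp [h]
  have hs' : 0 < s := lt_of_le_of_ne hs (Ne.symm h)
  rw [if_neg h, if_neg (hs'.trans_le hst).ne']
  exact ENNReal.ofReal_le_ofReal (neg_le_neg (Real.log_le_log hs' hst))

section

variable {γ : Measure ℝ} [IsProbabilityMeasure γ] {C : ℝ≥0∞}

/-- `C` bounds the mean negative logarithm of the distance to any real point. Then it does so for
complex points too, and the bound is additive in the roots. -/
theorem lintegral_negLog_multiset_le (hC : ∀ s, ∫⁻ y, negLog |y - s| ∂γ ≤ C) (S : Multiset ℂ) :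
    ∫⁻ y : ℝ, negLog (S.map fun z : ℂ => ‖(y : ℂ) - z‖).prod ∂γ ≤ Multiset.card S * C := by
  induction S using Multiset.induction_on with
  | empty => simp [negLog]
  | cons z S ih =>
    simp only [Multiset.map_cons, Multiset.prod_cons, Multiset.card_cons]
    have hm : Measurable fun y : ℝ => negLog ‖(y : ℂ) - z‖ := by fun_prop
    calc _ ≤ ∫⁻ y : ℝ, (negLog ‖(y : ℂ) - z‖ +
            negLog (S.map fun z : ℂ => ‖(y : ℂ) - z‖).prod) ∂γ :=
          lintegral_mono fun y => negLog_mul_le _ _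
      _ = ∫⁻ y : ℝ, negLog ‖(y : ℂ) - z‖ ∂γ + _ := lintegral_add_left hm _
      _ ≤ C + Multiset.card S * C := by
          refine add_le_add (le_trans (lintegral_mono fun y => ?_) (hC z.re)) ih
          refine negLog_anti (abs_nonneg _) ?_
          simpa using Complex.abs_re_le_norm ((y : ℂ) - z)
      _ = _ := by push_cast; ring

/-- Factorization over `ℂ` bounds the mean negative logarithm of a polynomial in one variable by
its leading coefficient and its degree alone. -/
theorem lintegral_negLog_polynomial_le (hC : ∀ s, ∫⁻ y, negLog |y - s| ∂γ ≤ C)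
    (Q : Polynomial ℝ) :
    ∫⁻ y, negLog |Q.eval y| ∂γ ≤ negLog |Q.leadingCoeff| + Q.natDegree * C := by
  set R : Polynomial ℂ := Q.map (algebraMap ℝ ℂ) with hR
  have hs : R.Splits := IsAlgClosed.splits R
  have hev : ∀ y : ℝ, |Q.eval y| =
      |Q.leadingCoeff| * (R.roots.map fun z : ℂ => ‖(y : ℂ) - z‖).prod := by
    intro y
    have h1 : R.eval (y : ℂ) = ((Q.eval y : ℝ) : ℂ) := by
      rw [hR, Polynomial.eval_map]
      exact Polynomial.eval₂_at_apply (algebraMap ℝ ℂ) y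
    have h2 := hs.eval_eq_prod_roots (y : ℂ)
    rw [h1] at h2
    have h3 := congrArg norm h2
    rw [Complex.norm_real, norm_mul, Real.norm_eq_abs] at h3
    rw [h3, hR, Polynomial.leadingCoeff_map]
    congr 1
    · simp
    · exact (map_multiset_prod (normHom : ℂ →*₀ ℝ) _).trans (by simp [Multiset.map_map])
  calc _ ≤ ∫⁻ y : ℝ, (negLog |Q.leadingCoeff| +
          negLog (R.roots.map fun z : ℂ => ‖(y : ℂ) - z‖).prod) ∂γ :=
        lintegral_mono fun y => by simp only [hev y]; exact negLog_mul_le _ _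
    _ = negLog |Q.leadingCoeff| +
          ∫⁻ y : ℝ, negLog (R.roots.map fun z : ℂ => ‖(y : ℂ) - z‖).prod ∂γ := by
        rw [lintegral_add_left measurable_const]; simp
    _ ≤ _ := by
        gcongr
        refine (lintegral_negLog_multiset_le hC _).trans ?_
        gcongr
        exact (Polynomial.card_roots' R).trans_eq (Polynomial.natDegree_map _)

@[fun_prop]
theorem measurable_mvPolynomial_eval {κ : Type*} (p : MvPolynomial κ ℝ) :
    Measurable fun x : κ → ℝ => MvPolynomial.eval x p := by
  induction p using MvPolynomial.induction_on with
  | C a => simp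
  | add p q hp hq => simp only [map_add]; exact hp.add hq
  | mul_X p i hp => simp only [map_mul, MvPolynomial.eval_X]; exact hp.mul (measurable_pi_apply i)

/-- Induction on the number of variables: the polynomial is regarded as a polynomial in the first
variable, whose leading coefficient is a polynomial in the others. -/
theorem lintegral_negLog_mvPolynomial_fin_lt_top (hC : ∀ s, ∫⁻ y, negLog |y - s| ∂γ ≤ C)
    (hC' : C ≠ ⊤) (n : ℕ) (p : MvPolynomial (Fin n) ℝ) (hp : p ≠ 0) :
    ∫⁻ x, negLog |MvPolynomial.eval x p| ∂(Measure.pi fun _ : Fin n => γ) < ⊤ := by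
  induction n with
  | zero =>
    have h : ∀ x, MvPolynomial.eval x p = MvPolynomial.eval 0 p := fun x => by
      rw [Subsingleton.elim x 0]
    simp_rw [h]
    have h0 : MvPolynomial.eval 0 p ≠ 0 := by
      intro h0
      apply hp
      rw [MvPolynomial.eq_C_of_isEmpty p] at h0 ⊢
      simpa using h0
    rw [lintegral_const, negLog, if_neg (by simpa using h0)]
    simp
  | succ n ih =>
    set q := MvPolynomial.finSuccEquiv ℝ n p with hq
    have hq0 : q ≠ 0 := by
      rw [hq]; exact (map_ne_zero_iff _ (MvPolynomial.finSuccEquiv ℝ n).injective).2 hp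
    have ha := ih q.leadingCoeff (Polynomial.leadingCoeff_ne_zero.2 hq0)
    rw [← ((measurePreserving_piFinSuccAbove (fun _ : Fin (n + 1) => γ) 0).symm).lintegral_comp_emb
      (MeasurableEquiv.measurableEmbedding _)]
    simp_rw [MeasurableEquiv.piFinSuccAbove_symm_apply, Fin.insertNthEquiv,
      Equiv.coe_fn_mk, Fin.insertNth_zero, MvPolynomial.eval_eq_eval_mv_eval', ← hq]
    have hm : Measurable fun z : ℝ × (Fin n → ℝ) =>
        negLog |Polynomial.eval z.1 (Polynomial.map (MvPolynomial.eval z.2) q)| := by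
      have h1 : Measurable fun z : ℝ × (Fin n → ℝ) =>
          (Fin.cons z.1 z.2 : Fin (n + 1) → ℝ) := by
        refine measurable_pi_iff.2 fun i => ?_
        refine Fin.cases ?_ (fun j => ?_) i
        · simpa using measurable_fst
        · simp only [Fin.cons_succ]
          fun_prop
      have h2 := (measurable_mvPolynomial_eval p).comp h1
      simp only [Function.comp_def, MvPolynomial.eval_eq_eval_mv_eval', ← hq] at h2
      fun_prop
    change ∫⁻ z : ℝ × (Fin n → ℝ), negLog |Polynomial.eval z.1 (Polynomial.map
      (MvPolynomial.eval z.2) q)| ∂(γ.prod (Measure.pi fun _ : Fin n => γ)) < ⊤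
    rw [lintegral_prod_symm _ hm.aemeasurable]
    calc _ ≤ ∫⁻ s, (negLog |MvPolynomial.eval s q.leadingCoeff| + q.natDegree * C)
            ∂(Measure.pi fun _ : Fin n => γ) := by
          refine lintegral_mono fun s => ?_
          by_cases h0 : MvPolynomial.eval s q.leadingCoeff = 0
          · simp [h0, negLog]
          refine (lintegral_negLog_polynomial_le hC
            (Polynomial.map (MvPolynomial.eval s) q)).trans ?_
          rw [Polynomial.leadingCoeff_map_of_leadingCoeff_ne_zero _ h0]
          gcongr
          exact Polynomial.natDegree_map_le
      _ = ∫⁻ s, negLog |MvPolynomial.eval s q.leadingCoeff| ∂(Measure.pi fun _ : Fin n => γ) +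
            q.natDegree * C := by
          rw [lintegral_add_right _ measurable_const]; simp
      _ < ⊤ := ENNReal.add_lt_top.2 ⟨ha, ENNReal.mul_lt_top (by simp) hC'.lt_top⟩

theorem lintegral_negLog_mvPolynomial_lt_top (hC : ∀ s, ∫⁻ y, negLog |y - s| ∂γ ≤ C)
    (hC' : C ≠ ⊤) {κ : Type*} [Fintype κ] (p : MvPolynomial κ ℝ) (hp : p ≠ 0) :
    ∫⁻ x, negLog |MvPolynomial.eval x p| ∂(Measure.pi fun _ : κ => γ) < ⊤ := by
  let e := (Fintype.equivFin κ).symm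
  rw [← (measurePreserving_piCongrLeft (fun _ : κ => γ) e).lintegral_comp_emb
    (MeasurableEquiv.measurableEmbedding _)]
  have h : ∀ x : Fin (Fintype.card κ) → ℝ,
      MvPolynomial.eval (MeasurableEquiv.piCongrLeft (fun _ => ℝ) e x) p =
        MvPolynomial.eval x (MvPolynomial.rename e.symm p) := by
    intro x
    rw [MvPolynomial.eval_rename]
    congr 2
    ext i
    obtain ⟨j, rfl⟩ := e.surjective i
    rw [MeasurableEquiv.coe_piCongrLeft, Equiv.piCongrLeft_apply_apply]
    simp
  simp_rw [h]
  exact lintegral_negLog_mvPolynomial_fin_lt_top hC hC' _ _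
    ((map_ne_zero_iff _ (MvPolynomial.rename_injective _ e.symm.injective)).2 hp)

end

/-- A Gaussian density is bounded, and the negative part of `log |y|` is Lebesgue integrable. -/
theorem exists_lintegral_negLog_gaussianReal_le {v : ℝ≥0} (hv : v ≠ 0) :
    ∃ C : ℝ≥0∞, C ≠ ⊤ ∧ ∀ s, ∫⁻ y, negLog |y - s| ∂(gaussianReal 0 v) ≤ C := by
  set D : ℝ≥0∞ := ENNReal.ofReal (√(2 * Real.pi * v))⁻¹
  have hfin : ∫⁻ y : ℝ, negLog |y| < ⊤ := by
    have h1 : IntegrableOn Real.log (Set.Icc (-1) 1) := by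
      rw [integrableOn_Icc_iff_integrableOn_Ioc, ← intervalIntegrable_iff_integrableOn_Ioc_of_le
        (by norm_num)]
      exact intervalIntegral.intervalIntegrable_log'
    calc ∫⁻ y : ℝ, negLog |y| = ∫⁻ y : ℝ, (Set.Icc (-1) 1).indicator
          (fun y => ‖Real.log y‖ₑ) y := by
          have h0 : ∀ᵐ y : ℝ, y ≠ 0 := by simp [ae_iff]
          refine lintegral_congr_ae ?_
          filter_upwards [h0] with y hy
          rw [negLog, if_neg (by simpa using hy), Real.log_abs]
          by_cases h : y ∈ Set.Icc (-1 : ℝ) 1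
          · have hl : Real.log y ≤ 0 := by
              rw [← Real.log_abs]
              exact Real.log_nonpos (abs_nonneg _) (abs_le.2 h)
            rw [Set.indicator_of_mem h, Real.enorm_eq_ofReal_abs, abs_of_nonpos hl]
          · rw [Set.indicator_of_notMem h]
            rw [← Real.log_abs]
            refine ENNReal.ofReal_of_nonpos (neg_nonpos.2 (Real.log_nonneg ?_))
            by_contra! h2
            exact h (abs_le.1 h2.le)
      _ < ⊤ := by
          rw [lintegral_indicator measurableSet_Icc]
          exact h1.2
  refine ⟨D * ∫⁻ y : ℝ, negLog |y|, ENNReal.mul_ne_top ENNReal.ofReal_ne_top hfin.ne, fun s => ?_⟩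
  rw [gaussianReal_of_var_ne_zero _ hv,
    lintegral_withDensity_eq_lintegral_mul _ (measurable_gaussianPDF 0 v) (by fun_prop),
    ← lintegral_sub_right_eq_self (fun y : ℝ => negLog |y|) s,
    ← lintegral_const_mul _ (by fun_prop)]
  refine lintegral_mono fun y => ?_
  simp only [Pi.mul_apply]
  gcongr
  rw [gaussianPDF, gaussianPDFReal]
  refine ENNReal.ofReal_le_ofReal (mul_le_of_le_one_right (by positivity) ?_)
  rw [Real.exp_le_one_iff]
  have : (0 : ℝ) ≤ v := v.2
  exact div_nonpos_of_nonpos_of_nonneg (neg_nonpos.2 (sq_nonneg _)) (by positivity)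

theorem integrable_mvPolynomial_pi_gaussianReal {κ : Type*} [Fintype κ] (v : ℝ≥0)
    (p : MvPolynomial κ ℝ) :
    Integrable (fun x => MvPolynomial.eval x p) (Measure.pi fun _ : κ => gaussianReal 0 v) := by
  simp_rw [MvPolynomial.eval_eq']
  refine integrable_finsetSum _ fun d _ => Integrable.const_mul ?_ _
  refine Integrable.fintype_prod (f := fun i y => y ^ d i) fun i => ?_
  exact integrable_pow_of_mem_interior_integrableExpSet (X := id) (by simp) _

/-- The zero set of a nonzero polynomial is Gaussian-null, since `negLog` is infinite there. -/
theorem ae_mvPolynomial_ne_zero {κ : Type*} [Fintype κ] {v : ℝ≥0} (hv : v ≠ 0)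
    {p : MvPolynomial κ ℝ} (hp : p ≠ 0) :
    ∀ᵐ x ∂(Measure.pi fun _ : κ => gaussianReal 0 v), MvPolynomial.eval x p ≠ 0 := by
  obtain ⟨C, hC', hC⟩ := exists_lintegral_negLog_gaussianReal_le hv
  have h := lintegral_negLog_mvPolynomial_lt_top hC hC' p hp
  filter_upwards [ae_lt_top (by fun_prop) h.ne] with x hx h0
  simp [negLog, h0] at hx

/-- A nonzero polynomial is log-integrable under a nondegenerate Gaussian. -/
theorem integrable_log_mvPolynomial {κ : Type*} [Fintype κ] {v : ℝ≥0} (hv : v ≠ 0)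
    {p : MvPolynomial κ ℝ} (hp : p ≠ 0) :
    Integrable (fun x => Real.log |MvPolynomial.eval x p|)
      (Measure.pi fun _ : κ => gaussianReal 0 v) := by
  obtain ⟨C, hC', hC⟩ := exists_lintegral_negLog_gaussianReal_le hv
  have h := lintegral_negLog_mvPolynomial_lt_top hC hC' p hp
  have h2 := (integrable_mvPolynomial_pi_gaussianReal v p).2
  refine ⟨(by fun_prop : Measurable _).aestronglyMeasurable, ?_⟩
  refine lt_of_le_of_lt (lintegral_mono (g := fun x => negLog |MvPolynomial.eval x p| +
    ‖MvPolynomial.eval x p‖ₑ) fun x => ?_) ?_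
  · set t := MvPolynomial.eval x p
    simp only
    by_cases ht : t = 0
    · rw [negLog, if_pos (by simpa using ht), top_add]
      exact le_top
    rw [negLog, if_neg (by simpa using ht), Real.enorm_eq_ofReal_abs, Real.enorm_eq_ofReal_abs]
    rcases le_total 0 (Real.log |t|) with h0 | h0
    · rw [abs_of_nonneg h0]
      exact le_add_left (ENNReal.ofReal_le_ofReal (Real.log_le_self (abs_nonneg _)))
    · rw [abs_of_nonpos h0]
      exact le_add_right le_rfl
  · rw [lintegral_add_right _ (by fun_prop)]
    exact ENNReal.add_lt_top.2 ⟨h, h2⟩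

/-! ### Change of variables for quadratic maps -/

section QuadraticMap

variable {κ : Type*} [Fintype κ] {G : (κ → ℝ) → κ → ℝ} {G' : (κ → ℝ) → (κ → ℝ) →L[ℝ] κ → ℝ}

/-- For a quadratic map, differences are values of the derivative at the midpoint. Hence it is
injective on every convex set on which its Jacobian determinant does not vanish. -/
theorem injOn_of_midpoint_identity
    (hmid : ∀ x x', G x - G x' = G' ((1 / 2 : ℝ) • (x + x')) (x - x')) {B : Set (κ → ℝ)}
    (hB : Convex ℝ B) (hdet : ∀ x ∈ B, (G' x).det ≠ 0) : Set.InjOn G B := by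
  intro x hx x' hx' h
  have hm : (1 / 2 : ℝ) • (x + x') ∈ B := by
    rw [smul_add]
    exact hB hx hx' (by norm_num) (by norm_num) (by norm_num)
  have h1 := hmid x x'
  rw [h, sub_self] at h1
  have hu : IsUnit ((G' ((1 / 2 : ℝ) • (x + x')) : (κ → ℝ) →L[ℝ] κ → ℝ) : (κ → ℝ) →ₗ[ℝ] κ → ℝ) :=
    (LinearMap.isUnit_iff_isUnit_det _).2 (isUnit_iff_ne_zero.2 (hdet _ hm))
  have hinj := ((Module.End.isUnit_iff _).1 hu).injective
  exact sub_eq_zero.1 (hinj (by rw [map_zero]; exact h1.symm))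

/-- The change of variables formula on a convex set where the Jacobian determinant does not
vanish, with test functions depending on the components of `G`. -/
theorem setLIntegral_det_mul_prod_le (hG : ∀ x, HasFDerivAt G (G' x) x)
    (hmid : ∀ x x', G x - G x' = G' ((1 / 2 : ℝ) • (x + x')) (x - x')) {B : Set (κ → ℝ)}
    (hB : Convex ℝ B) (hBm : MeasurableSet B) (hdet : ∀ x ∈ B, (G' x).det ≠ 0)
    {ψ : κ → ℝ → ℝ≥0∞} (hψ : ∀ j, Measurable (ψ j)) :
    ∫⁻ x in B, ENNReal.ofReal |(G' x).det| * ∏ j, ψ j (G x j) ≤ ∏ j, ∫⁻ s, ψ j s := by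
  rw [← lintegral_image_eq_lintegral_abs_det_fderiv_mul volume hBm
    (fun x _ => (hG x).hasFDerivWithinAt) (injOn_of_midpoint_identity hmid hB hdet)
    (fun v => ∏ j, ψ j (v j))]
  exact (setLIntegral_le_lintegral _ _).trans_eq (lintegral_pi_prod (fun _ => volume) hψ)

/-- The distance to the closed set `S`, truncated at `1`. -/
noncomputable def truncDist (S : Set (κ → ℝ)) (x : κ → ℝ) : ℝ := min 1 (Metric.infDist x S)

theorem continuous_truncDist (S : Set (κ → ℝ)) : Continuous (truncDist S) :=
  continuous_const.min (Metric.continuous_infDist_pt S)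

theorem truncDist_le_add_dist (S : Set (κ → ℝ)) (x y : κ → ℝ) :
    truncDist S x ≤ truncDist S y + dist x y := by
  have h := Metric.infDist_le_infDist_add_dist (s := S) (x := x) (y := y)
  unfold truncDist
  rcases min_choice 1 (Metric.infDist y S) with h1 | h1
  · rw [h1]; exact (min_le_left _ _).trans (by linarith [dist_nonneg (x := x) (y := y)])
  · rw [h1]; exact (min_le_right _ _).trans h

/-- In the family of the balls with centre `y` and radius `truncDist S y / 2`, the centres of those
which contain `x` fill a volume at least comparable to `truncDist S x ^ N`. -/
theorem ofReal_truncDist_pow_le_volume {S : Set (κ → ℝ)} {x : κ → ℝ} (hx : 0 < truncDist S x) :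
    ENNReal.ofReal ((2 / 3 * truncDist S x) ^ Fintype.card κ) ≤
      volume {y | dist x y < truncDist S y / 2} := by
  have h := Real.volume_pi_ball x (r := truncDist S x / 3) (by positivity)
  rw [show 2 / 3 * truncDist S x = 2 * (truncDist S x / 3) by ring, ← h]
  refine measure_mono fun y hy => ?_
  rw [Metric.mem_ball, dist_comm] at hy
  have := truncDist_le_add_dist S x y
  rw [Set.mem_ofPred_eq]
  linarith

/-- Change of variables for a quadratic map `G`, some of whose components `G_i` are tested by
`ψ_i` and whose other components vary by at most `K` on unit balls. Weighted by the Jacobian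
determinant and by a power of the distance to its zero set, the push-forward of a density `D`
under the tested components is bounded by Lebesgue measure. -/
theorem lintegral_det_truncDist_mul_prod_le {ι₁ ι₂ : Type*} [Fintype ι₁] [Fintype ι₂]
    (e : κ ≃ ι₁ ⊕ ι₂) (hG : ∀ x, HasFDerivAt G (G' x) x)
    (hmid : ∀ x x', G x - G x' = G' ((1 / 2 : ℝ) • (x + x')) (x - x'))
    (hJ : Continuous fun x => (G' x).det) (hS : ∃ x, (G' x).det = 0)
    {ψ : ι₁ → ℝ → ℝ≥0∞} (hψ : ∀ i, Measurable (ψ i)) {K : ℝ}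
    (hK : ∀ x y, dist x y ≤ 1 → ∀ k, |G x (e.symm (.inr k)) - G y (e.symm (.inr k))| ≤ K)
    {D D' : (κ → ℝ) → ℝ≥0∞} (hD : Measurable D) (hD' : Measurable D')
    (hDD' : ∀ x y, dist x y ≤ 1 → D x ≤ D' y) :
    ∫⁻ x, ENNReal.ofReal (|(G' x).det| *
        (2 / 3 * truncDist {x | (G' x).det = 0} x) ^ Fintype.card κ) *
        (∏ i, ψ i (G x (e.symm (.inl i)))) * D x ≤
      (∫⁻ y, D' y) * (ENNReal.ofReal (2 * K) ^ Fintype.card ι₂ * ∏ i, ∫⁻ s, ψ i s) := by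
  set S : Set (κ → ℝ) := {x | (G' x).det = 0} with hSdef
  have hSc : IsClosed S := isClosed_singleton.preimage hJ
  have hGc : Continuous G := continuous_iff_continuousAt.2 fun x => (hG x).continuousAt
  set f : (κ → ℝ) → ℝ≥0∞ := fun x => ENNReal.ofReal |(G' x).det| *
    (∏ i, ψ i (G x (e.symm (.inl i)))) with hf
  have hfm : Measurable f := by
    refine (hJ.abs.measurable.ennreal_ofReal).mul (Finset.measurable_prod _ fun i _ => ?_)
    exact (hψ i).comp ((continuous_apply _).comp hGc).measurable
  let T : Set ((κ → ℝ) × (κ → ℝ)) := {z | dist z.1 z.2 < truncDist S z.2 / 2}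
  have hT : MeasurableSet T := by
    refine (isOpen_lt (by fun_prop) ?_).measurableSet
    exact ((continuous_truncDist S).comp continuous_snd).div_const 2
  -- a point is covered by the balls often enough to absorb the power of its distance to `S`
  have hpt : ∀ x, ENNReal.ofReal (|(G' x).det| * (2 / 3 * truncDist S x) ^ Fintype.card κ) *
      (∏ i, ψ i (G x (e.symm (.inl i)))) * D x ≤
      ∫⁻ y, T.indicator (fun z => f z.1 * D z.1) (x, y) := by
    intro x
    have e1 : ∫⁻ y, T.indicator (fun z => f z.1 * D z.1) (x, y) =
        f x * D x * volume {y | dist x y < truncDist S y / 2} := by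
      have hm : MeasurableSet {y | dist x y < truncDist S y / 2} := measurable_prodMk_left hT
      rw [← setLIntegral_const, ← lintegral_indicator hm]
      rfl
    rw [e1]
    by_cases hx : (G' x).det = 0
    · simp [hx]
    have hxS : x ∉ S := hx
    have hpos : 0 < truncDist S x :=
      lt_min one_pos ((hSc.notMem_iff_infDist_pos hS).1 hxS)
    rw [ENNReal.ofReal_mul (abs_nonneg _)]
    calc _ = f x * D x * ENNReal.ofReal ((2 / 3 * truncDist S x) ^ Fintype.card κ) := by
          simp only [hf]; ring
      _ ≤ _ := by gcongr; exact ofReal_truncDist_pow_le_volume hpos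
  -- on one ball `G` is injective, and the untested components stay in intervals of length `2 * K`
  have hloc : ∀ y, ∫⁻ x in Metric.ball y (truncDist S y / 2), f x ≤
      ENNReal.ofReal (2 * K) ^ Fintype.card ι₂ * ∏ i, ∫⁻ s, ψ i s := by
    intro y
    have hball : ∀ x ∈ Metric.ball y (truncDist S y / 2), dist x y ≤ 1 ∧ (G' x).det ≠ 0 := by
      intro x hx
      rw [Metric.mem_ball] at hx
      have h1 : truncDist S y ≤ 1 := min_le_left _ _
      have h2 : truncDist S y ≤ Metric.infDist y S := min_le_right _ _
      refine ⟨by linarith [dist_nonneg (x := x) (y := y)], fun h => ?_⟩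
      have h3 := Metric.infDist_le_dist_of_mem (x := y) (show x ∈ S from h)
      rw [dist_comm] at h3
      linarith [dist_nonneg (x := x) (y := y)]
    let I : ι₂ → Set ℝ := fun k => Set.Icc (G y (e.symm (.inr k)) - K) (G y (e.symm (.inr k)) + K)
    let Ψ : κ → ℝ → ℝ≥0∞ := fun j =>
      Sum.elim ψ (fun k => (I k).indicator 1) (e j)
    have hΨ : ∀ j, Measurable (Ψ j) := by
      intro j
      simp only [Ψ]
      rcases e j with i | k
      · exact hψ i
      · exact measurable_one.indicator measurableSet_Icc
    calc ∫⁻ x in Metric.ball y (truncDist S y / 2), f x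
        ≤ ∫⁻ x in Metric.ball y (truncDist S y / 2),
            ENNReal.ofReal |(G' x).det| * ∏ j, Ψ j (G x j) := by
          refine setLIntegral_mono' Metric.isOpen_ball.measurableSet fun x hx => ?_
          rw [← e.symm.prod_comp, Fintype.prod_sum_type]
          have h1 : ∀ k, Ψ (e.symm (.inr k)) (G x (e.symm (.inr k))) = 1 := by
            intro k
            have := abs_le.1 (hK x y (hball x hx).1 k)
            simp only [Ψ, Equiv.apply_symm_apply, Sum.elim_inr]
            rw [Set.indicator_of_mem, Pi.one_apply]
            exact ⟨by linarith, by linarith⟩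
          simp [h1, hf, Ψ]
      _ ≤ ∏ j, ∫⁻ s, Ψ j s :=
          setLIntegral_det_mul_prod_le hG hmid (convex_ball _ _) Metric.isOpen_ball.measurableSet
            (fun x hx => (hball x hx).2) hΨ
      _ = _ := by
          rw [← e.symm.prod_comp, Fintype.prod_sum_type, mul_comm]
          congr 1
          · have h1 : ∀ k, ∫⁻ s, Ψ (e.symm (.inr k)) s = ENNReal.ofReal (2 * K) := by
              intro k
              simp only [Ψ, Equiv.apply_symm_apply, Sum.elim_inr]
              rw [lintegral_indicator_one measurableSet_Icc, Real.volume_Icc]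
              congr 1
              ring
            simp [h1]
          · simp [Ψ]
  calc _ ≤ ∫⁻ x, ∫⁻ y, T.indicator (fun z => f z.1 * D z.1) (x, y) := lintegral_mono hpt
    _ = ∫⁻ y, ∫⁻ x, T.indicator (fun z => f z.1 * D z.1) (x, y) := by
        refine lintegral_lintegral_swap ?_
        exact (((hfm.comp measurable_fst).mul (hD.comp measurable_fst)).indicator hT).aemeasurable
    _ ≤ ∫⁻ y, D' y * (ENNReal.ofReal (2 * K) ^ Fintype.card ι₂ * ∏ i, ∫⁻ s, ψ i s) := by
        refine lintegral_mono fun y => ?_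
        calc ∫⁻ x, T.indicator (fun z => f z.1 * D z.1) (x, y)
            = ∫⁻ x in Metric.ball y (truncDist S y / 2), f x * D x := by
              rw [← lintegral_indicator Metric.isOpen_ball.measurableSet]; rfl
          _ ≤ ∫⁻ x in Metric.ball y (truncDist S y / 2), D' y * f x := by
              refine setLIntegral_mono' Metric.isOpen_ball.measurableSet fun x hx => ?_
              rw [mul_comm]
              gcongr
              refine hDD' x y ?_
              rw [Metric.mem_ball] at hx
              have h1 : truncDist S y ≤ 1 := min_le_left _ _
              linarith [dist_nonneg (x := x) (y := y)]
          _ = D' y * ∫⁻ x in Metric.ball y (truncDist S y / 2), f x := lintegral_const_mul _ hfm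
          _ ≤ _ := by gcongr; exact hloc y
    _ = _ := lintegral_mul_const _ hD'

end QuadraticMap

/-! ### Generic matrices: full spark and the rank of the quadratic system -/

section FullSpark

variable {ι κ : Type*} [Fintype κ]

/-- A family of vectors in `ℂ^κ` has full spark if any `|κ|` or fewer of its members are linearly
independent. The bound on the size keeps the notion meaningful for families with fewer than `|κ|`
members. -/
def FullSpark (h : ι → κ → ℂ) : Prop :=
  ∀ s : Finset ι, s.card ≤ Fintype.card κ → LinearIndepOn ℂ h (s : Set ι)

theorem FullSpark.comp {ι' : Type*} {h : ι → κ → ℂ} (hh : FullSpark h) {f : ι' → ι}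
    (hf : f.Injective) : FullSpark (h ∘ f) := by
  intro s hs
  have h1 := hh (s.map ⟨f, hf⟩) (by simpa using hs)
  rw [Finset.coe_map] at h1
  exact h1.comp_of_image hf.injOn

/-- Full spark is a generic property: it is implied by the nonvanishing of finitely many minors. -/
theorem holdsForGeneric_fullSpark (m n : ℕ) :
    HoldsForGeneric fun H : Matrix (Fin m) (Fin n) ℂ => FullSpark H := by
  classical
  have key : ∀ s : Finset (Fin m), s.card ≤ n → ∃ q : MvPolynomial (Fin m × Fin n) ℂ, q ≠ 0 ∧
      ∀ H : Matrix (Fin m) (Fin n) ℂ, MvPolynomial.eval (fun ik => H ik.1 ik.2) q ≠ 0 →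
        LinearIndepOn ℂ H (s : Set (Fin m)) := by
    intro s hs
    obtain ⟨φ⟩ : Nonempty (s ↪ Fin n) :=
      Function.Embedding.nonempty_of_card_le (by simpa using hs)
    have hinj : Function.Injective fun p : s × s => ((p.1 : Fin m), φ p.2) := by
      rintro ⟨a, b⟩ ⟨c, d⟩ h
      simp only [Prod.mk.injEq, EmbeddingLike.apply_eq_iff_eq] at h
      exact Prod.ext (Subtype.ext h.1) h.2
    refine ⟨MvPolynomial.rename (fun p : s × s => ((p.1 : Fin m), φ p.2))
      (Matrix.mvPolynomialX s s ℂ).det, ?_, fun H hH => ?_⟩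
    · exact (map_ne_zero_iff _ (MvPolynomial.rename_injective _ hinj)).2
        (Matrix.det_mvPolynomialX_ne_zero s ℂ)
    · rw [MvPolynomial.eval_rename] at hH
      have h1 : (Matrix.of fun a b : s => H a (φ b)).det ≠ 0 := by
        rw [RingHom.map_det] at hH
        convert hH using 2
        ext a b
        simp
      have h2 := Matrix.linearIndependent_rows_iff_isUnit.2
        ((Matrix.isUnit_iff_isUnit_det _).2 (isUnit_iff_ne_zero.2 h1))
      exact LinearIndependent.of_comp (LinearMap.funLeft ℂ ℂ φ) h2
  choose! q hq0 hq using key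
  refine ⟨∏ s ∈ Finset.univ.filter (fun s : Finset (Fin m) => s.card ≤ n), q s,
    Finset.prod_ne_zero_iff.2 fun s hs => hq0 s (Finset.mem_filter.1 hs).2, fun H hH s hs => ?_⟩
  rw [Fintype.card_fin] at hs
  rw [map_prod] at hH
  exact hq s hs H (Finset.prod_ne_zero_iff.1 hH s (by simpa using hs))

end FullSpark

/-- If an affine family of `m` vectors `A i + z • B i` over `ℂ` is linearly independent at one
complex parameter `z`, it is linearly independent at some real parameter: a determinant that is
polynomial in `z` does not vanish identically on the real line. -/
theorem exists_real_linearIndependent_affine {m : ℕ} {V : Type*} [AddCommGroup V] [Module ℂ V]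
    (A B : Fin m → V) (z : ℂ) (h : LinearIndependent ℂ fun i => A i + z • B i) :
    ∃ τ : ℝ, LinearIndependent ℂ fun i => A i + (τ : ℂ) • B i := by
  obtain ⟨φ, hφ⟩ := LinearMap.exists_leftInverse_of_injective
    (Fintype.linearCombination ℂ fun i => A i + z • B i)
    (LinearMap.ker_eq_bot.2 (by
      rwa [linearIndependent_iff_injective_fintypeLinearCombination] at h))
  let M : Matrix (Fin m) (Fin m) (Polynomial ℂ) :=
    Matrix.of fun i j => Polynomial.C (φ (A i) j) + Polynomial.X * Polynomial.C (φ (B i) j)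
  have hM : ∀ w : ℂ, M.det.eval w = (Matrix.of fun i j => φ (A i + w • B i) j).det := by
    intro w
    rw [← Polynomial.coe_evalRingHom, RingHom.map_det]
    congr 1
    ext i j
    simp [M, mul_comm w]
  have h1 : (Matrix.of fun i j => φ (A i + z • B i) j) = (1 : Matrix (Fin m) (Fin m) ℂ) := by
    ext i j
    have := congrFun (LinearMap.congr_fun hφ (Pi.single i 1)) j
    simp only [LinearMap.comp_apply, Fintype.linearCombination_apply_single, one_smul,
      LinearMap.id_apply] at this
    rw [Matrix.of_apply, this, Matrix.one_apply, Pi.single_apply]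
    simp [eq_comm]
  have h0 : M.det ≠ 0 := by
    intro h0
    have := hM z
    rw [h0, h1] at this
    simp at this
  obtain ⟨τ, hτ⟩ : ∃ τ : ℝ, M.det.eval (τ : ℂ) ≠ 0 := by
    by_contra! hall
    refine h0 (Polynomial.eq_zero_of_infinite_isRoot _ ?_)
    refine (Set.infinite_range_of_injective Complex.ofReal_injective).mono ?_
    rintro _ ⟨τ, rfl⟩
    exact hall τ
  refine ⟨τ, ?_⟩
  rw [hM] at hτ
  have h2 := Matrix.linearIndependent_rows_iff_isUnit.2
    ((Matrix.isUnit_iff_isUnit_det _).2 (isUnit_iff_ne_zero.2 hτ))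
  exact LinearIndependent.of_comp φ h2

open ComplexConjugate in
/-- For a full spark family of at most `2 n - 1` vectors in `ℂ^n`, the map
`x ↦ (|h i ⬝ᵥ x|²)_i` is a submersion at some point. Treating `x` and `conj x` as independent
variables, it suffices to choose the first one off all hyperplanes `h i = 0` and the second one
on these hyperplanes exactly for the indices `i ≥ n`. -/
theorem FullSpark.exists_conj_mul_linearIndependent {m n : ℕ} (hn : 1 ≤ n) (hm : m ≤ 2 * n - 1)
    {h : Fin m → Fin n → ℂ} (hh : FullSpark h) :
    ∃ x : Fin n → ℂ, ∀ t : Fin m → ℝ, (∑ i, ((t i : ℂ) * conj (h i ⬝ᵥ x)) • h i) = 0 → t = 0 := by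
  classical
  set I₂ : Finset (Fin m) := Finset.univ.filter fun i => n ≤ i.val with hI₂
  have hcard : I₂.card ≤ n - 1 := by
    have : I₂.card ≤ (Finset.Ico n m).card := by
      refine Finset.card_le_card_of_injOn (fun i => i.val) (fun i hi => ?_)
        (Fin.val_injective.injOn)
      have := (Finset.mem_filter.1 hi).2
      simp only [Finset.coe_Ico, Set.mem_Ico]
      exact ⟨this, i.2⟩
    rw [Nat.card_Ico] at this
    omega
  have hcard1 : (I₂ᶜ).card ≤ n := by
    have : (I₂ᶜ).card ≤ (Finset.range n).card := by
      refine Finset.card_le_card_of_injOn (fun i => i.val) (fun i hi => ?_)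
        (Fin.val_injective.injOn)
      simpa [hI₂] using hi
    simpa using this
  have hne : ∀ i, h i ≠ 0 := fun i => by
    have := hh {i} (by simpa using hn)
    exact this.ne_zero (by simp)
  obtain ⟨g, hg⟩ := Module.exists_dual_forall_apply_ne_zero (K := ℂ) h hne
  obtain ⟨f, hf, hf'⟩ := Module.Dual.exists_forall_mem_ne_zero_of_forall_exists
    (K := ℂ) (Submodule.span ℂ (h '' (I₂ : Set (Fin m)))).dualAnnihilator
    (fun i : {i // i ∉ I₂} => Module.Dual.eval ℂ (Fin n → ℂ) (h i)) (by
      rintro ⟨i, hi⟩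
      have h1 := hh (insert i I₂) (by
        rw [Fintype.card_fin]
        exact (Finset.card_insert_le _ _).trans (by omega))
      rw [Finset.coe_insert] at h1
      have h2 : h i ∉ Submodule.span ℂ (h '' (I₂ : Set (Fin m))) :=
        h1.notMem_span_of_insert (by simpa using hi)
      obtain ⟨φ, hφ, hφ'⟩ := Submodule.exists_le_ker_of_notMem h2
      exact ⟨φ, (Submodule.mem_dualAnnihilator _).2 fun w hw => hφ' hw, hφ⟩)
  have hf2 : ∀ i ∈ I₂, f (h i) = 0 := fun i hi =>
    (Submodule.mem_dualAnnihilator _).1 hf _ (Submodule.subset_span ⟨i, hi, rfl⟩)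
  have hf1 : ∀ i, i ∉ I₂ → f (h i) ≠ 0 := fun i hi => hf' ⟨i, hi⟩
  have hdot : ∀ (φ : Module.Dual ℂ (Fin n → ℂ)) (v : Fin n → ℂ),
      φ v = v ⬝ᵥ fun k => φ (Pi.single k 1) := by
    intro φ v
    conv_lhs => rw [← Finset.univ_sum_single v, map_sum]
    refine Finset.sum_congr rfl fun k _ => ?_
    rw [← smul_eq_mul, ← map_smul, ← Pi.single_smul]
    simp
  -- the segment `c + z d` joins, at `z = i` and after complexification, the pair `(g, conj f)`
  let c : Module.Dual ℂ (Fin n → ℂ) := (1 / 2 : ℂ) • (g + f)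
  let d : Module.Dual ℂ (Fin n → ℂ) := (-Complex.I / 2) • (g - f)
  let A : Fin m → (Fin n → ℂ) × (Fin n → ℂ) := fun i =>
    (conj (c (h i)) • h i, c (h i) • fun k => conj (h i k))
  let B : Fin m → (Fin n → ℂ) × (Fin n → ℂ) := fun i =>
    (conj (d (h i)) • h i, d (h i) • fun k => conj (h i k))
  have hI : LinearIndependent ℂ fun i => A i + Complex.I • B i := by
    have e1 : ∀ i, A i + Complex.I • B i =
        (conj (f (h i)) • h i, g (h i) • fun k => conj (h i k)) := by
      intro i
      have e2 : conj (c (h i)) + Complex.I * conj (d (h i)) = conj (f (h i)) := by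
        simp only [c, d, LinearMap.smul_apply, LinearMap.add_apply, LinearMap.sub_apply,
          smul_eq_mul, map_mul, map_add, map_sub, map_div₀, map_neg, Complex.conj_I, map_one,
          map_ofNat]
        linear_combination (1 / 2 * (conj (g (h i)) - conj (f (h i)))) * Complex.I_sq
      have e3 : c (h i) + Complex.I * d (h i) = g (h i) := by
        simp only [c, d, LinearMap.smul_apply, LinearMap.add_apply, LinearMap.sub_apply,
          smul_eq_mul]
        linear_combination (-1 / 2 * (g (h i) - f (h i))) * Complex.I_sq
      rw [← e2, ← e3]
      simp only [A, B, Prod.smul_mk, Prod.mk_add_mk, add_smul, mul_smul]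
    simp_rw [e1]
    rw [Fintype.linearIndependent_iff]
    intro t ht
    have ht1 : ∑ i, (t i * conj (f (h i))) • h i = 0 := by
      have := congrArg Prod.fst ht
      simpa [Prod.fst_sum, smul_smul] using this
    have ht2 : ∑ i, (t i * g (h i)) • (fun k => conj (h i k)) = 0 := by
      have := congrArg Prod.snd ht
      simpa [Prod.snd_sum, smul_smul] using this
    have h1 : ∀ i, i ∉ I₂ → t i = 0 := by
      have hs := linearIndepOn_finset_iff.1 (hh I₂ᶜ (by rwa [Fintype.card_fin]))
        (fun i => t i * conj (f (h i))) (by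
          rw [← ht1]
          refine Finset.sum_subset (Finset.subset_univ _) fun i _ hi => ?_
          rw [hf2 i (by simpa using hi)]
          simp)
      intro i hi
      have := hs i (by simpa using hi)
      simpa [hf1 i hi] using this
    have ht2' : ∑ i, conj (t i * g (h i)) • h i = 0 := by
      ext k
      have := congrArg conj (congrFun ht2 k)
      simpa using this
    have h2 : ∀ i ∈ I₂, t i = 0 := by
      have hs := linearIndepOn_finset_iff.1 (hh I₂ (by rw [Fintype.card_fin]; omega))
        (fun i => conj (t i * g (h i))) (by
          rw [← ht2']
          refine Finset.sum_subset (Finset.subset_univ _) fun i _ hi => ?_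
          rw [h1 i hi]
          simp)
      intro i hi
      have := hs i hi
      simpa [hg i] using this
    intro i
    by_cases hi : i ∈ I₂
    · exact h2 i hi
    · exact h1 i hi
  obtain ⟨τ, hτ⟩ := exists_real_linearIndependent_affine A B Complex.I hI
  let u : Module.Dual ℂ (Fin n → ℂ) := c + (τ : ℂ) • d
  refine ⟨fun k => u (Pi.single k 1), fun t ht => ?_⟩
  have e4 : ∀ i, A i + (τ : ℂ) • B i =
      (conj (u (h i)) • h i, u (h i) • fun k => conj (h i k)) := by
    intro i
    simp only [A, B, u, LinearMap.add_apply, LinearMap.smul_apply, Prod.smul_mk, Prod.mk_add_mk,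
      add_smul, mul_smul, map_add, smul_eq_mul, map_mul, Complex.conj_ofReal]
  simp_rw [e4] at hτ
  simp_rw [← hdot u] at ht
  have ht' : ∑ i, ((t i : ℂ) * u (h i)) • (fun k => conj (h i k)) = 0 := by
    ext k
    have := congrArg conj (congrFun ht k)
    simpa using this
  have := Fintype.linearIndependent_iff.1 hτ (fun i => (t i : ℂ)) (by
    refine Prod.ext ?_ ?_
    · simpa [Prod.fst_sum, smul_smul] using ht
    · simpa [Prod.snd_sum, smul_smul] using ht')
  ext i
  exact_mod_cast this i

/-! ### Polynomial growth and truncated distance weights -/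

/-- Polynomials in several variables grow at most polynomially and are Lipschitz at unit scale
with a constant of polynomial growth. -/
theorem exists_mvPolynomial_growth {κ : Type*} [Fintype κ] (p : MvPolynomial κ ℝ) :
    ∃ (C : ℝ) (d : ℕ), 0 ≤ C ∧ (∀ x, |MvPolynomial.eval x p| ≤ C * (1 + ‖x‖) ^ d) ∧
      ∀ x y, dist x y ≤ 1 → |MvPolynomial.eval x p - MvPolynomial.eval y p| ≤
        C * (1 + ‖x‖) ^ d * dist x y := by
  induction p using MvPolynomial.induction_on with
  | C a => exact ⟨|a|, 0, abs_nonneg _, by simp, fun x y _ => by simp; positivity⟩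
  | add p q hp hq =>
    obtain ⟨C, d, hC, h1, h2⟩ := hp
    obtain ⟨C', d', hC', h1', h2'⟩ := hq
    have hle : ∀ x : κ → ℝ, C * (1 + ‖x‖) ^ d + C' * (1 + ‖x‖) ^ d' ≤
        (C + C') * (1 + ‖x‖) ^ (d + d') := by
      intro x
      have h : (1 : ℝ) ≤ 1 + ‖x‖ := by linarith [norm_nonneg x]
      rw [add_mul]
      gcongr <;> first | exact h | omega
    refine ⟨C + C', d + d', add_nonneg hC hC', fun x => ?_, fun x y hxy => ?_⟩
    · rw [map_add]
      exact (abs_add_le _ _).trans ((add_le_add (h1 x) (h1' x)).trans (hle x))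
    · rw [map_add, map_add, add_sub_add_comm]
      refine (abs_add_le _ _).trans ((add_le_add (h2 x y hxy) (h2' x y hxy)).trans ?_)
      rw [← add_mul]
      exact mul_le_mul_of_nonneg_right (hle x) dist_nonneg
  | mul_X p i hp =>
    obtain ⟨C, d, hC, h1, h2⟩ := hp
    refine ⟨2 * C, d + 1, by positivity, fun x => ?_, fun x y hxy => ?_⟩
    · rw [map_mul, MvPolynomial.eval_X, abs_mul, pow_succ]
      have hx : |x i| ≤ 1 + ‖x‖ := by
        have := norm_le_pi_norm x i
        rw [Real.norm_eq_abs] at this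
        linarith
      calc _ ≤ C * (1 + ‖x‖) ^ d * (1 + ‖x‖) :=
            mul_le_mul (h1 x) hx (abs_nonneg _) (by positivity)
        _ ≤ _ := by
          have : 0 ≤ C * ((1 + ‖x‖) ^ d * (1 + ‖x‖)) := by positivity
          linarith
    · rw [map_mul, map_mul, MvPolynomial.eval_X, MvPolynomial.eval_X]
      set a := MvPolynomial.eval x p
      set b := MvPolynomial.eval y p
      set N := C * (1 + ‖x‖) ^ d with hN
      have hN0 : 0 ≤ N := by positivity
      have hx : |x i| ≤ ‖x‖ := by simpa using norm_le_pi_norm x i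
      have hxy' : |x i - y i| ≤ dist x y := by
        rw [← Real.dist_eq]; exact dist_le_pi_dist x y i
      have hb : |b| ≤ 2 * N := by
        have e : b = a - (a - b) := by ring
        rw [e]
        refine (abs_sub _ _).trans ?_
        have := h2 x y hxy
        have := h1 x
        nlinarith
      have e : a * x i - b * y i = (a - b) * x i + b * (x i - y i) := by ring
      rw [e, pow_succ]
      calc |(a - b) * x i + b * (x i - y i)| ≤ |a - b| * |x i| + |b| * |x i - y i| := by
            rw [← abs_mul, ← abs_mul]; exact abs_add_le _ _
        _ ≤ N * dist x y * ‖x‖ + 2 * N * dist x y := by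
            gcongr
            exact h2 x y hxy
        _ ≤ 2 * C * ((1 + ‖x‖) ^ d * (1 + ‖x‖)) * dist x y := by
            have : 2 * C * ((1 + ‖x‖) ^ d * (1 + ‖x‖)) = 2 * N * (1 + ‖x‖) := by
              rw [hN]; ring
            rw [this]
            have : 0 ≤ N * dist x y * ‖x‖ := by positivity
            nlinarith

theorem integrable_norm_pi_gaussianReal {κ : Type*} [Fintype κ] (v : ℝ≥0) :
    Integrable (fun x : κ → ℝ => ‖x‖) (Measure.pi fun _ : κ => gaussianReal 0 v) := by
  have h : Integrable (fun x : κ → ℝ => ∑ k, |MvPolynomial.eval x (MvPolynomial.X k)|)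
      (Measure.pi fun _ : κ => gaussianReal 0 v) :=
    integrable_finsetSum _ fun k _ => (integrable_mvPolynomial_pi_gaussianReal v _).abs
  refine h.mono' continuous_norm.aestronglyMeasurable (.of_forall fun x => ?_)
  rw [norm_norm]
  refine (pi_norm_le_iff_of_nonneg (Finset.sum_nonneg fun k _ => abs_nonneg _)).2 fun k => ?_
  have := Finset.single_le_sum (f := fun k => |MvPolynomial.eval x (MvPolynomial.X k)|)
    (fun k _ => abs_nonneg _) (Finset.mem_univ k)
  simpa using this

/-- The distance to the zero set of a polynomial is log-integrable under a Gaussian, since it is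
bounded below by the polynomial itself up to a factor of polynomial growth. -/
theorem integrable_log_truncDist {κ : Type*} [Fintype κ] {v : ℝ≥0} (hv : v ≠ 0)
    {p : MvPolynomial κ ℝ} (hp : p ≠ 0) (hS : ∃ x, MvPolynomial.eval x p = 0) :
    Integrable (fun x => Real.log (truncDist {x | MvPolynomial.eval x p = 0} x))
      (Measure.pi fun _ : κ => gaussianReal 0 v) := by
  set S : Set (κ → ℝ) := {x | MvPolynomial.eval x p = 0} with hSdef
  have hSc : IsClosed S := isClosed_singleton.preimage (MvPolynomial.continuous_eval p)
  obtain ⟨C₀, d, hC₀, -, hlip₀⟩ := exists_mvPolynomial_growth p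
  set C := C₀ + 1
  have hC : 1 ≤ C := by simp only [C]; linarith
  have hlip : ∀ x y, dist x y ≤ 1 → |MvPolynomial.eval x p - MvPolynomial.eval y p| ≤
        C * (1 + ‖x‖) ^ d * dist x y := fun x y h => (hlip₀ x y h).trans (by
          gcongr; simp only [C]; linarith)
  have hbound : Integrable (fun x : κ → ℝ => Real.log C + d * ‖x‖ +
      |Real.log (|MvPolynomial.eval x p|)|) (Measure.pi fun _ : κ => gaussianReal 0 v) :=
    ((integrable_const _).add ((integrable_norm_pi_gaussianReal v).const_mul _)).add
      (integrable_log_mvPolynomial hv hp).abs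
  refine hbound.mono' ((continuous_truncDist S).measurable.log.aestronglyMeasurable) ?_
  filter_upwards [ae_mvPolynomial_ne_zero hv hp] with x hx
  have hxS : x ∉ S := hx
  have hd0 : 0 < Metric.infDist x S := (hSc.notMem_iff_infDist_pos hS).1 hxS
  have hpos : 0 < truncDist S x := lt_min one_pos hd0
  have hl1 : Real.log (truncDist S x) ≤ 0 := Real.log_nonpos hpos.le (min_le_left _ _)
  have hN1 : (1 : ℝ) ≤ 1 + ‖x‖ := by linarith [norm_nonneg x]
  have hlogC := Real.log_nonneg hC
  rw [Real.norm_of_nonpos hl1]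
  rcases le_total 1 (Metric.infDist x S) with h1 | h1
  · have : truncDist S x = 1 := min_eq_left h1
    rw [this, Real.log_one, neg_zero]
    positivity
  -- compare with a nearest zero `z`: `|p x| = |p x - p z| ≤ C * (1 + ‖x‖) ^ d * dist x z`
  · have h2 : truncDist S x = Metric.infDist x S := min_eq_right h1
    obtain ⟨z, hz, hxz⟩ := hSc.exists_infDist_eq_dist hS x
    have h3 := hlip x z (hxz ▸ h1)
    have hz0 : MvPolynomial.eval z p = 0 := hz
    rw [hz0, sub_zero, ← hxz, ← h2] at h3
    have h4 := Real.log_le_log (abs_pos.2 hx) h3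
    rw [Real.log_mul (by positivity) hpos.ne', Real.log_mul (by positivity) (by positivity),
      Real.log_pow] at h4
    have h5 : Real.log (1 + ‖x‖) ≤ ‖x‖ := by
      have := Real.log_le_sub_one_of_pos (show 0 < 1 + ‖x‖ by positivity)
      linarith
    have h6 : (d : ℝ) * Real.log (1 + ‖x‖) ≤ d * ‖x‖ := by gcongr
    have h7 := neg_abs_le (Real.log |MvPolynomial.eval x p|)
    linarith

/-! ### The weight of a system of quadratic forms -/

theorem sumExtend_inl {ι K V : Type*} [DivisionRing K] [AddCommGroup V] [Module K V] {v : ι → V}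
    (hs : LinearIndependent K v) (i : ι) : Module.Basis.sumExtend hs (.inl i) = v i := by
  simp only [Module.Basis.sumExtend, Module.Basis.reindex_apply, Module.Basis.coe_extend]
  rfl

/-- Linearly independent functionals on `ℝ^κ` can be completed to a square system of functionals
with nonvanishing determinant. -/
theorem exists_functionals_det_ne_zero {κ ι₁ : Type*} [Fintype κ] [DecidableEq κ] [Fintype ι₁]
    {r : ι₁ → Module.Dual ℝ (κ → ℝ)} (hr : LinearIndependent ℝ r) :
    ∃ (n : ℕ) (e : κ ≃ ι₁ ⊕ Fin n) (L : Fin n → Module.Dual ℝ (κ → ℝ)),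
      (Matrix.of fun j l => Sum.elim r L (e j) (Pi.single l 1)).det ≠ 0 := by
  classical
  let b := Module.Basis.sumExtend hr
  have : Finite (ι₁ ⊕ Module.Basis.sumExtendIndex hr) := Module.Finite.finite_basis b
  have : Finite (Module.Basis.sumExtendIndex hr) := Finite.sum_right ι₁
  let f := Finite.equivFin (Module.Basis.sumExtendIndex hr)
  let b' := b.reindex ((Equiv.refl ι₁).sumCongr f)
  have hcard : Fintype.card κ =
      Fintype.card (ι₁ ⊕ Fin (Nat.card (Module.Basis.sumExtendIndex hr))) := by
    rw [← Module.finrank_eq_card_basis b', Subspace.dual_finrank_eq,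
      Module.finrank_fintype_fun_eq_card]
  let e := Fintype.equivOfCardEq hcard
  refine ⟨_, e, fun k => b' (.inr k), ?_⟩
  have hb : ∀ j, Sum.elim r (fun k => b' (.inr k)) (e j) = b'.reindex e.symm j := by
    intro j
    rw [Module.Basis.reindex_apply, Equiv.symm_symm]
    rcases e j with i | k
    · simp only [Sum.elim_inl, b', b]
      rw [Module.Basis.reindex_apply]
      exact (sumExtend_inl hr i).symm
    · rfl
  simp_rw [hb]
  let Φ : Module.Dual ℝ (κ → ℝ) →ₗ[ℝ] κ → ℝ :=
    { toFun := fun φ l => φ (Pi.single l 1)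
      map_add' := fun _ _ => rfl
      map_smul' := fun _ _ => rfl }
  have hΦ : LinearMap.ker Φ = ⊥ := by
    refine LinearMap.ker_eq_bot'.2 fun φ hφ => ?_
    refine LinearMap.pi_ext' fun l => LinearMap.ext_ring ?_
    exact congrFun hφ l
  have h := (b'.reindex e.symm).linearIndependent.map' Φ hΦ
  exact isUnit_iff_ne_zero.1 ((Matrix.isUnit_iff_isUnit_det _).1
    (Matrix.linearIndependent_rows_iff_isUnit.1 h))

/-- On balls of radius `1`, the Gaussian density is dominated by a wider integrable Gaussian
function evaluated at any other point of the ball. -/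
theorem exists_gaussian_density_bound (κ : Type*) [Fintype κ] {v : ℝ≥0} (hv : v ≠ 0) :
    ∃ D D' : (κ → ℝ) → ℝ≥0∞, Measurable D ∧ Measurable D' ∧
      (Measure.pi fun _ : κ => gaussianReal 0 v) = (volume : Measure (κ → ℝ)).withDensity D ∧
      (∀ x y, dist x y ≤ 1 → D x ≤ D' y) ∧ ∫⁻ y, D' y ≠ ⊤ := by
  have hv0 : (0 : ℝ) < v := by positivity
  let g : ℝ → ℝ≥0∞ := fun y => ENNReal.ofReal ((√(2 * Real.pi * v))⁻¹ * Real.exp (1 / (2 * v))) *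
    ENNReal.ofReal (Real.exp (-(1 / (4 * v)) * (y - 0) ^ 2))
  have hg : Measurable g := by fun_prop
  refine ⟨fun x => ∏ k, gaussianPDF 0 v (x k), fun y => ∏ k, g (y k),
    Finset.measurable_prod _ fun k _ => (measurable_gaussianPDF 0 v).comp (measurable_pi_apply k),
    Finset.measurable_prod _ fun k _ => hg.comp (measurable_pi_apply k), ?_, ?_, ?_⟩
  · rw [gaussianReal_of_var_ne_zero _ hv]
    have : SigmaFinite ((volume : Measure ℝ).withDensity (gaussianPDF 0 v)) := by
      rw [← gaussianReal_of_var_ne_zero _ hv]; infer_instance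
    exact pi_withDensity (fun _ : κ => (volume : Measure ℝ)) fun _ => measurable_gaussianPDF 0 v
  · intro x y hxy
    refine Finset.prod_le_prod' fun k _ => ?_
    have hk : |x k - y k| ≤ 1 := by
      rw [← Real.dist_eq]; exact (dist_le_pi_dist x y k).trans hxy
    simp only [g]
    rw [gaussianPDF, gaussianPDFReal, ← ENNReal.ofReal_mul (by positivity),
      mul_assoc (_)⁻¹ (Real.exp _) (Real.exp _), ← Real.exp_add]
    refine ENNReal.ofReal_le_ofReal (mul_le_mul_of_nonneg_left (Real.exp_le_exp.2 ?_)
      (by positivity))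
    -- `y ^ 2 ≤ 2 * x ^ 2 + 2` allows to pass from `x` to `y` at the price of doubling the variance
    have h1 : (x k - y k) ^ 2 ≤ 1 := by
      rw [← sq_abs]; exact pow_le_one₀ (abs_nonneg _) hk
    have h2 : y k ^ 2 ≤ 2 * x k ^ 2 + 2 := by nlinarith [sq_nonneg (2 * x k - y k)]
    have e : 1 / (2 * (v : ℝ)) + -(1 / (4 * v)) * (y k - 0) ^ 2 - -(x k - 0) ^ 2 / (2 * v) =
        (2 * x k ^ 2 + 2 - y k ^ 2) / (4 * v) := by
      field_simp
      ring
    have h3 : 0 ≤ (2 * x k ^ 2 + 2 - y k ^ 2) / (4 * (v : ℝ)) :=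
      div_nonneg (by linarith) (by positivity)
    linarith
  · rw [volume_pi, lintegral_pi_prod (fun _ : κ => (volume : Measure ℝ)) fun _ => hg]
    refine ENNReal.prod_ne_top fun k _ => ?_
    simp only [g]
    rw [lintegral_const_mul _ (by fun_prop), lintegral_gaussian_shift (by positivity)]
    exact ENNReal.mul_ne_top ENNReal.ofReal_ne_top ENNReal.ofReal_ne_top

/-- Non-degenerate quadratic forms `F i x = B i x x` in a Gaussian vector have, after weighting by
a log-integrable function, a joint law dominated by Lebesgue measure. -/
theorem exists_weight_quadratic {κ ι₁ : Type*} [Fintype κ] [Fintype ι₁] [Nonempty ι₁]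
    {v : ℝ≥0} (hv : v ≠ 0) (B : ι₁ → (κ → ℝ) →ₗ[ℝ] Module.Dual ℝ (κ → ℝ))
    (hsymm : ∀ i x y, B i x y = B i y x) {x₀ : κ → ℝ}
    (hx₀ : LinearIndependent ℝ fun i => B i x₀) :
    ∃ (w : (κ → ℝ) → ℝ) (C : ℝ≥0∞), Measurable w ∧
      (∀ᵐ x ∂(Measure.pi fun _ : κ => gaussianReal 0 v), 0 < w x) ∧
      Integrable (fun x => Real.log (w x)) (Measure.pi fun _ : κ => gaussianReal 0 v) ∧ C ≠ ⊤ ∧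
      ∀ ψ : ι₁ → ℝ → ℝ≥0∞, (∀ i, Measurable (ψ i)) →
        ∫⁻ x, ENNReal.ofReal (w x) * ∏ i, ψ i (B i x x) ∂(Measure.pi fun _ : κ => gaussianReal 0 v)
          ≤ C * ∏ i, ∫⁻ s, ψ i s := by
  classical
  have hx₀' : LinearIndependent ℝ fun i => (2 : ℝ) • B i x₀ := by
    exact hx₀.units_smul fun _ => Units.mk0 (2 : ℝ) two_ne_zero
  obtain ⟨n, e, L, hL⟩ := exists_functionals_det_ne_zero hx₀'
  obtain ⟨D, D', hD, hD', hpi, hDD', hfin⟩ := exists_gaussian_density_bound κ hv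
  -- the square quadratic map completing `F` by the linear functionals `L`, and its derivative
  let G : (κ → ℝ) → κ → ℝ := fun x j => Sum.elim (fun i => B i x x) (fun k => L k x) (e j)
  let dG : (κ → ℝ) → (κ → ℝ) →ₗ[ℝ] κ → ℝ := fun x =>
    LinearMap.pi fun j => Sum.elim (fun i => (2 : ℝ) • B i x) L (e j)
  let G' : (κ → ℝ) → (κ → ℝ) →L[ℝ] κ → ℝ := fun x => LinearMap.toContinuousLinearMap (dG x)
  have hG'apply : ∀ x b j, G' x b j = Sum.elim (fun i => (2 : ℝ) • B i x) L (e j) b :=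
    fun x b j => rfl
  have hmid : ∀ x x', G x - G x' = G' ((1 / 2 : ℝ) • (x + x')) (x - x') := by
    intro x x'
    ext j
    rw [hG'apply, Pi.sub_apply]
    simp only [G]
    rcases e j with i | k
    · simp only [Sum.elim_inl, map_smul, map_add, map_sub, LinearMap.smul_apply,
        LinearMap.add_apply, smul_eq_mul, hsymm i x' x]
      ring
    · simp
  have hG : ∀ x, HasFDerivAt G (G' x) x := by
    intro x
    rw [hasFDerivAt_pi']
    intro j
    rw [show (fun y => G y j) = fun y =>
      Sum.elim (fun i => B i y y) (fun k => L k y) (e j) from rfl]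
    have hc : (ContinuousLinearMap.proj j).comp (G' x) =
        LinearMap.toContinuousLinearMap (Sum.elim (fun i => (2 : ℝ) • B i x) L (e j)) := by
      ext b; rfl
    rw [hc]
    rcases e j with i | k
    · simp only [Sum.elim_inl]
      have h1 : HasFDerivAt (fun y => (LinearMap.toContinuousLinearMap
          ((LinearMap.toContinuousLinearMap : ((κ → ℝ) →ₗ[ℝ] ℝ) ≃ₗ[ℝ] _).toLinearMap ∘ₗ B i) y) y)
          _ x := (ContinuousLinearMap.hasFDerivAt _).clm_apply (hasFDerivAt_id x)
      refine h1.congr_fderiv ?_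
      refine ContinuousLinearMap.ext fun b => ?_
      simp [hsymm i b x]
      ring
    · exact (LinearMap.toContinuousLinearMap (L k)).hasFDerivAt
  have hGc : Continuous G := continuous_iff_continuousAt.2 fun x => (hG x).continuousAt
  -- the Jacobian determinant is a polynomial
  let M : Matrix κ κ (MvPolynomial κ ℝ) := Matrix.of fun j l =>
    Sum.elim (fun i => ∑ k, MvPolynomial.C (2 * B i (Pi.single k 1) (Pi.single l 1)) *
      MvPolynomial.X k) (fun k => MvPolynomial.C (L k (Pi.single l 1))) (e j)
  have hMeval : ∀ x, (M.map (MvPolynomial.eval x)) =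
      Matrix.of fun j l => Sum.elim (fun i => (2 : ℝ) • B i x) L (e j) (Pi.single l 1) := by
    intro x
    ext j l
    simp only [M, Matrix.map_apply, Matrix.of_apply]
    rcases e j with i | k
    · simp only [Sum.elim_inl, map_sum, map_mul, MvPolynomial.eval_C, MvPolynomial.eval_X]
      conv_rhs => rw [← Finset.univ_sum_single x]
      rw [map_sum, LinearMap.smul_apply, LinearMap.sum_apply, smul_eq_mul, Finset.mul_sum]
      refine Finset.sum_congr rfl fun k _ => ?_
      rw [show (Pi.single k (x k) : κ → ℝ) = x k • Pi.single k 1 by rw [← Pi.single_smul]; simp,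
        map_smul, LinearMap.smul_apply, smul_eq_mul]
      ring
    · simp
  have hJ : ∀ x, (G' x).det = MvPolynomial.eval x M.det := by
    intro x
    rw [RingHom.map_det, RingHom.mapMatrix_apply, hMeval]
    change LinearMap.det (dG x) = _
    rw [← LinearMap.det_toMatrix']
    congr 1
  have hM0 : M.det ≠ 0 := by
    intro h0
    apply hL
    rw [← hMeval x₀, ← RingHom.mapMatrix_apply, ← RingHom.map_det, h0, map_zero]
  have hS : ∃ x, MvPolynomial.eval x M.det = 0 := by
    refine ⟨0, ?_⟩
    obtain ⟨i⟩ := ‹Nonempty ι₁›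
    rw [RingHom.map_det, RingHom.mapMatrix_apply, hMeval]
    exact Matrix.det_eq_zero_of_row_eq_zero (e.symm (.inl i)) fun l => by simp
  set S : Set (κ → ℝ) := {x | MvPolynomial.eval x M.det = 0} with hSdef
  have hSc : IsClosed S := isClosed_singleton.preimage (MvPolynomial.continuous_eval _)
  have hpos : ∀ x, MvPolynomial.eval x M.det ≠ 0 → 0 < truncDist S x := fun x hx =>
    lt_min one_pos ((hSc.notMem_iff_infDist_pos hS).1 hx)
  let K : ℝ := ∑ k, ‖LinearMap.toContinuousLinearMap (L k)‖
  let N := Fintype.card κ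
  refine ⟨fun x => |MvPolynomial.eval x M.det| * (2 / 3 * truncDist S x) ^ N,
    (∫⁻ y, D' y) * ENNReal.ofReal (2 * K) ^ Fintype.card (Fin n), ?_, ?_, ?_, ?_, ?_⟩
  · exact (measurable_mvPolynomial_eval _).abs.mul
      (((continuous_truncDist S).measurable.const_mul _).pow_const _)
  · filter_upwards [ae_mvPolynomial_ne_zero hv hM0] with x hx
    have := hpos x hx
    have := abs_pos.2 hx
    positivity
  · have h1 := (integrable_log_mvPolynomial hv hM0).add
      (((integrable_const (Real.log (2 / 3))).add
        (integrable_log_truncDist hv hM0 hS)).const_mul (N : ℝ))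
    refine h1.congr ?_
    filter_upwards [ae_mvPolynomial_ne_zero hv hM0] with x hx
    have h2 := hpos x hx
    have h3 := abs_pos.2 hx
    rw [Real.log_mul h3.ne' (by positivity), Real.log_pow, Real.log_mul (by norm_num) h2.ne']
    rfl
  · exact ENNReal.mul_ne_top hfin (ENNReal.pow_ne_top ENNReal.ofReal_ne_top)
  · intro ψ hψ
    have key := lintegral_det_truncDist_mul_prod_le e hG hmid
      (by simp_rw [hJ]; exact MvPolynomial.continuous_eval _) (by simp_rw [hJ]; exact hS) hψ
      (K := K) ?_ hD hD' hDD'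
    · simp_rw [hJ] at key
      rw [hpi, lintegral_withDensity_eq_lintegral_mul _ hD]
      · refine le_trans (le_of_eq ?_) (key.trans_eq (mul_assoc _ _ _).symm)
        refine lintegral_congr fun x => ?_
        simp only [Pi.mul_apply, G, Equiv.apply_symm_apply, Sum.elim_inl]
        rw [mul_comm]
      · refine (((measurable_mvPolynomial_eval _).abs.mul
          (((continuous_truncDist S).measurable.const_mul _).pow_const _)).ennreal_ofReal).mul
          (Finset.measurable_prod _ fun i _ => (hψ i).comp ?_)
        have h1 := ((continuous_apply (e.symm (.inl i))).comp hGc).measurable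
        simpa [Function.comp_def, G] using h1
    · intro x y hxy k
      simp only [G, Equiv.apply_symm_apply, Sum.elim_inr]
      rw [← map_sub, ← Real.norm_eq_abs]
      have h1 := (LinearMap.toContinuousLinearMap (L k)).le_opNorm (x - y)
      rw [← dist_eq_norm] at h1
      refine h1.trans ((mul_le_of_le_one_right (norm_nonneg _) hxy).trans ?_)
      exact Finset.single_le_sum (f := fun k => ‖LinearMap.toContinuousLinearMap (L k)‖)
        (fun _ _ => norm_nonneg _) (Finset.mem_univ k)

/-! ### Complex Gaussian vectors -/

theorem complexGaussian_eq_withDensity {v : ℝ≥0} (hv : v ≠ 0) :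
    complexGaussian v = (volume : Measure ℂ).withDensity fun z =>
      ENNReal.ofReal ((Real.pi * v)⁻¹ * Real.exp (-‖z‖ ^ 2 / v)) := by
  have hv2 : v / 2 ≠ 0 := by positivity
  have hv0 : (0 : ℝ) < v := by positivity
  have hmap : (fun p : ℝ × ℝ => (⟨p.1, p.2⟩ : ℂ)) = Complex.measurableEquivRealProd.symm := by
    ext p
    rfl
  have hmp := Complex.volume_preserving_equiv_real_prod.symm
  rw [complexGaussian, gaussianReal_of_var_ne_zero _ hv2,
    prod_withDensity (measurable_gaussianPDF _ _) (measurable_gaussianPDF _ _), hmap]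
  ext s hs
  rw [Measure.map_apply (MeasurableEquiv.measurable _) hs, withDensity_apply _ hs,
    withDensity_apply _ (MeasurableEquiv.measurable _ hs), ← hmp.setLIntegral_comp_preimage_emb
    (MeasurableEquiv.measurableEmbedding _)]
  refine lintegral_congr fun p => ?_
  rw [gaussianPDF, gaussianPDF, ← ENNReal.ofReal_mul (gaussianPDFReal_nonneg _ _ _)]
  congr 1
  have h1 : ‖Complex.measurableEquivRealProd.symm p‖ ^ 2 = p.1 ^ 2 + p.2 ^ 2 := by
    rw [Complex.sq_norm, Complex.normSq_apply, Complex.measurableEquivRealProd_symm_apply]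
    ring
  rw [h1, gaussianPDFReal, gaussianPDFReal, mul_mul_mul_comm, ← Real.exp_add, ← mul_inv,
    Real.mul_self_sqrt (by positivity)]
  push_cast
  congr 2
  · field_simp
  · field_simp
    ring

instance isProbabilityMeasure_complexGaussian (v : ℝ≥0) :
    IsProbabilityMeasure (complexGaussian v) := by
  unfold complexGaussian
  refine Measure.isProbabilityMeasure_map (Measurable.aemeasurable ?_)
  exact Complex.measurableEquivRealProd.symm.measurable

instance isProbabilityMeasure_complexGaussianVec (n : ℕ) (v : ℝ≥0) :
    IsProbabilityMeasure (complexGaussianVec n v) := by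
  unfold complexGaussianVec
  infer_instance

theorem measurePreserving_phase_mul_complexGaussian {v : ℝ≥0} (hv : v ≠ 0) (θ : ℝ) :
    MeasurePreserving (fun z => Complex.exp (θ * Complex.I) * z) (complexGaussian v)
      (complexGaussian v) := by
  let R := rotation (Circle.exp θ)
  have hR : (fun z => Complex.exp (θ * Complex.I) * z) = R := by
    ext z
    simp [R, rotation_apply]
  have hmp : MeasurePreserving R (volume : Measure ℂ) volume := R.measurePreserving
  rw [hR]
  refine ⟨R.continuous.measurable, ?_⟩
  rw [complexGaussian_eq_withDensity hv]
  ext s hs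
  rw [Measure.map_apply R.continuous.measurable hs, withDensity_apply _ hs,
    withDensity_apply _ (R.continuous.measurable hs),
    ← hmp.setLIntegral_comp_preimage hs (by fun_prop)]
  simp

/-- `CN(0, v I)` is invariant under independent phase rotations of the coordinates. -/
theorem map_phase_mul_complexGaussianVec {n : ℕ} {v : ℝ≥0} (hv : v ≠ 0) (θ : Fin n → ℝ) :
    (complexGaussianVec n v).map (fun x k => Complex.exp (θ k * Complex.I) * x k) =
      complexGaussianVec n v :=
  (measurePreserving_pi _ _ fun k => measurePreserving_phase_mul_complexGaussian hv (θ k)).map_eq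

/-- The complex vector with real parts `x (inl k)` and imaginary parts `x (inr k)`. -/
noncomputable def toComplexVec {n : ℕ} (x : Fin n ⊕ Fin n → ℝ) : Fin n → ℂ :=
  fun k => ⟨x (.inl k), x (.inr k)⟩

/-- `CN(0, v I)` is the law of `√P` times a standardized Gaussian vector in real coordinates. -/
theorem measurePreserving_smul_toComplexVec {n : ℕ} {P : ℝ} (hP : 0 ≤ P) {s v : ℝ≥0}
    (h : (v : ℝ) / 2 = P * s) :
    MeasurePreserving (fun x : Fin n ⊕ Fin n → ℝ => (√P : ℂ) • toComplexVec x)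
      (Measure.pi fun _ => gaussianReal 0 s) (complexGaussianVec n v) := by
  have h1 : MeasurePreserving (fun p : ℝ × ℝ => (√P : ℂ) * ⟨p.1, p.2⟩)
      ((gaussianReal 0 s).prod (gaussianReal 0 s)) (complexGaussian v) := by
    have hm : Measurable fun p : ℝ × ℝ => (⟨p.1, p.2⟩ : ℂ) :=
      Complex.measurableEquivRealProd.symm.measurable
    have hg : MeasurePreserving (fun x => √P * x) (gaussianReal 0 s) (gaussianReal 0 (v / 2)) := by
      refine ⟨by fun_prop, ?_⟩
      rw [gaussianReal_map_const_mul]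
      congr 1
      · simp
      · ext
        push_cast
        rw [h, Real.sq_sqrt hP]
    have h2 := (show MeasurePreserving _ _ (complexGaussian v) from ⟨hm, rfl⟩).comp (hg.prod hg)
    have h3 : (fun p : ℝ × ℝ => (√P : ℂ) * ⟨p.1, p.2⟩) =
        (fun p : ℝ × ℝ => (⟨p.1, p.2⟩ : ℂ)) ∘ Prod.map (fun x => √P * x) fun x => √P * x := by
      funext p
      apply Complex.ext <;> simp
    rw [h3]
    exact h2
  have h2 := measurePreserving_sumPiEquivProdPi
    (fun _ : Fin n ⊕ Fin n => gaussianReal 0 s)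
  have h3 := (measurePreserving_arrowProdEquivProdArrow ℝ ℝ (Fin n) (fun _ => gaussianReal 0 s)
    (fun _ => gaussianReal 0 s)).symm
  have h4 := measurePreserving_pi (fun _ : Fin n => (gaussianReal 0 s).prod (gaussianReal 0 s))
    (fun _ => complexGaussian v) fun _ => h1
  exact h4.comp (h3.comp h2)

theorem complexGaussianVec_one_eq_withDensity (n : ℕ) :
    complexGaussianVec n 1 = (volume : Measure (Fin n → ℂ)).withDensity fun z =>
      ∏ i, ENNReal.ofReal (Real.pi⁻¹ * Real.exp (-‖z i‖ ^ 2)) := by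
  have h1 : complexGaussian 1 = (volume : Measure ℂ).withDensity fun z =>
      ENNReal.ofReal (Real.pi⁻¹ * Real.exp (-‖z‖ ^ 2)) := by
    rw [complexGaussian_eq_withDensity one_ne_zero]
    simp
  have : SigmaFinite ((volume : Measure ℂ).withDensity fun z =>
      ENNReal.ofReal (Real.pi⁻¹ * Real.exp (-‖z‖ ^ 2))) := by
    rw [← h1]; infer_instance
  rw [complexGaussianVec, h1]
  exact pi_withDensity (fun _ : Fin n => (volume : Measure ℂ)) fun _ => by fun_prop

/-! ### Entropy of a signal in additive noise -/

section AdditiveNoise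

variable {A V : Type*} [MeasurableSpace A] {η : Measure A} [IsProbabilityMeasure η]
  [AddCommGroup V] [MeasureSpace V] [MeasurableAdd₂ V] [MeasurableSub₂ V]
  [SigmaFinite (volume : Measure V)] [(volume : Measure V).IsAddLeftInvariant]
  {W : A → V} {φ : V → ℝ}

/-- With noise density at most `1`, the output density is at most `1` as well, and the entropy of
the output is the Lebesgue integral of `- p log₂ p ≥ 0`. -/
theorem diffEntropy_map_add (hW : Measurable W) (hφ : Measurable φ) (hφ0 : ∀ z, 0 ≤ φ z)
    (hφ1 : ∀ z, φ z ≤ 1) :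
    diffEntropy ((η.prod ((volume : Measure V).withDensity fun z => ENNReal.ofReal (φ z))).map
        (fun q => W q.1 + q.2)) =
      ((∫⁻ y, ENNReal.ofReal (Real.negMulLog (∫ a, φ (y - W a) ∂η) / Real.log 2) : ℝ≥0∞) :
        EReal) := by
  have hm2 : Measurable fun q : V × A => φ (q.1 - W q.2) :=
    hφ.comp (measurable_fst.sub (hW.comp measurable_snd))
  have hi : ∀ y, Integrable (fun a => φ (y - W a)) η := fun y =>
    .of_bound (hm2.comp measurable_prodMk_left).aestronglyMeasurable 1 (.of_forall fun a => by
      rw [Real.norm_of_nonneg (hφ0 _)]; exact hφ1 _)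
  rw [map_add_eq_withDensity hW hφ.ennreal_ofReal]
  have h1 : (fun y => ∫⁻ a, ENNReal.ofReal (φ (y - W a)) ∂η) =
      fun y => ENNReal.ofReal (∫ a, φ (y - W a) ∂η) := by
    funext y
    rw [ofReal_integral_eq_lintegral_ofReal (hi y) (.of_forall fun a => hφ0 _)]
  rw [h1]
  refine diffEntropy_withDensity ?_ (fun y => integral_nonneg fun a => hφ0 _) fun y => ?_
  · exact (hm2.stronglyMeasurable.integral_prod_right (ν := η)).measurable
  · calc ∫ a, φ (y - W a) ∂η ≤ ∫ _, (1 : ℝ) ∂η :=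
          integral_mono (hi y) (integrable_const _) fun a => hφ1 _
      _ = 1 := by simp

theorem zero_le_diffEntropy_map_add (hW : Measurable W) (hφ : Measurable φ) (hφ0 : ∀ z, 0 ≤ φ z)
    (hφ1 : ∀ z, φ z ≤ 1) :
    0 ≤ diffEntropy ((η.prod ((volume : Measure V).withDensity fun z => ENNReal.ofReal (φ z))).map
        (fun q => W q.1 + q.2)) := by
  rw [diffEntropy_map_add hW hφ hφ0 hφ1]
  exact EReal.coe_ennreal_nonneg _

/-- The entropy of a signal `W` in independent noise is bounded below as soon as the noise
density averaged over the signal, with a log-integrable weight, is uniformly bounded. -/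
theorem le_diffEntropy_map_add (hW : Measurable W) (hφ : Measurable φ) (hφ0 : ∀ z, 0 ≤ φ z)
    (hφ1 : ∀ z, φ z ≤ 1) (hφint : ∫⁻ z, ENNReal.ofReal (φ z) = 1) {wt : A → ℝ} {C : ℝ}
    (hwt : Measurable wt) (hpos : ∀ᵐ a ∂η, 0 < wt a)
    (hlog : Integrable (fun a => Real.log (wt a)) η) (hC : 0 < C)
    (hle : ∀ y, ∫⁻ a, ENNReal.ofReal (wt a * φ (y - W a)) ∂η ≤ ENNReal.ofReal C) :
    (((∫ a, Real.log (wt a) ∂η - Real.log C) / Real.log 2 : ℝ) : EReal) ≤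
      diffEntropy ((η.prod ((volume : Measure V).withDensity fun z => ENNReal.ofReal (φ z))).map
        (fun q => W q.1 + q.2)) := by
  have h2 : 0 < Real.log 2 := Real.log_pos one_lt_two
  have hm2 : Measurable fun q : A × V => φ (q.2 - W q.1) :=
    hφ.comp (measurable_snd.sub (hW.comp measurable_fst))
  have key := integral_log_le_lintegral_negMulLog_mixture (K := fun a y => φ (y - W a)) hm2 hwt
    (fun a y => hφ0 _) (fun a y => hφ1 _) (fun a => by
      rw [← hφint]
      simp_rw [sub_eq_neg_add]
      exact lintegral_add_left_eq_self (fun z => ENNReal.ofReal (φ z)) (-W a)) hpos hlog hC hle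
  rw [diffEntropy_map_add hW hφ hφ0 hφ1]
  refine le_trans (le_max_left _ (0 : EReal)) ?_
  have h3 := EReal.coe_ennreal_ofReal
    (x := (∫ a, Real.log (wt a) ∂η - Real.log C) / Real.log 2)
  have h4 : max (((∫ a, Real.log (wt a) ∂η - Real.log C) / Real.log 2 : ℝ) : EReal) 0 =
      ((ENNReal.ofReal ((∫ a, Real.log (wt a) ∂η - Real.log C) / Real.log 2) : ℝ≥0∞) : EReal) := by
    rw [h3]; norm_cast
  rw [h4, EReal.coe_ennreal_le_coe_ennreal_iff]
  simp_rw [div_eq_mul_inv, ENNReal.ofReal_mul' (inv_pos.2 h2).le]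
  rw [lintegral_mul_const' _ _ ENNReal.ofReal_ne_top]
  gcongr

end AdditiveNoise

section PhaseDensity

variable {n : ℕ} {ν : Measure (Fin n → ℝ)} [IsProbabilityMeasure ν]

/-- A law carried by `S`, divided by the maximum of its density and `1`, is dominated by Lebesgue
measure on `S`. -/
theorem lintegral_inv_max_rnDeriv_mul_le (hac : ν ≪ volume) {S : Set (Fin n → ℝ)}
    (hS : MeasurableSet S) (hνS : ∀ᵐ θ ∂ν, θ ∈ S) {g : (Fin n → ℝ) → ℝ≥0∞} (hg : Measurable g) :
    ∫⁻ θ, ENNReal.ofReal (max (ν.rnDeriv volume θ).toReal 1)⁻¹ * g θ ∂ν ≤ ∫⁻ θ in S, g θ := by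
  have hr := Measure.measurable_rnDeriv ν volume
  have hr' := Measure.rnDeriv_lt_top ν volume
  have h2 := Measure.withDensity_rnDeriv_eq _ _ hac
  generalize ν.rnDeriv volume = r at hr hr' h2
  have hk : Measurable fun θ => ENNReal.ofReal (max (r θ).toReal 1)⁻¹ * g θ := by fun_prop
  calc ∫⁻ θ, ENNReal.ofReal (max (r θ).toReal 1)⁻¹ * g θ ∂ν
      = ∫⁻ θ in S, ENNReal.ofReal (max (r θ).toReal 1)⁻¹ * g θ ∂ν := by
        rw [Measure.restrict_eq_self_of_ae_mem hνS]
    _ = ∫⁻ θ in S, r θ * (ENNReal.ofReal (max (r θ).toReal 1)⁻¹ * g θ) := by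
        rw [← h2, setLIntegral_withDensity_eq_setLIntegral_mul _ hr hk hS]
        rfl
    _ ≤ ∫⁻ θ in S, g θ := by
        refine lintegral_mono_ae (ae_restrict_of_ae ?_)
        filter_upwards [hr'] with θ hθ
        have h3 : (0 : ℝ) < max (r θ).toReal 1 := lt_max_of_lt_right one_pos
        rw [← mul_assoc]
        refine mul_le_of_le_one_left' ?_
        rw [← ENNReal.ofReal_toReal hθ.ne, ENNReal.toReal_ofReal ENNReal.toReal_nonneg,
          ← ENNReal.ofReal_mul ENNReal.toReal_nonneg, ← div_eq_mul_inv, ENNReal.ofReal_le_one]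
        exact (div_le_one h3).2 (le_max_left _ _)

/-- Only the negative part of the entropy integrand, coming from large values of the density, has
to be integrable. -/
theorem integrable_log_max_rnDeriv (hac : ν ≪ volume)
    (h : ∫⁻ θ, ENNReal.ofReal (-entropyIntegrand ν θ) ≠ ⊤) :
    Integrable (fun θ => Real.log (max (ν.rnDeriv volume θ).toReal 1)) ν := by
  have hr := Measure.measurable_rnDeriv ν volume
  have hr' := Measure.rnDeriv_lt_top ν volume
  have h2 := Measure.withDensity_rnDeriv_eq _ _ hac
  unfold entropyIntegrand at h
  generalize ν.rnDeriv volume = r at hr hr' h2 h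
  have hlog2 : 0 < Real.log 2 := Real.log_pos one_lt_two
  have hm : Measurable fun θ => Real.log (max (r θ).toReal 1) := by fun_prop
  refine ⟨hm.aestronglyMeasurable, ?_⟩
  rw [hasFiniteIntegral_iff_ofReal (.of_forall fun θ => Real.log_nonneg (le_max_right _ _)), ← h2,
    lintegral_withDensity_eq_lintegral_mul _ hr hm.ennreal_ofReal]
  refine lt_of_le_of_lt (lintegral_mono_ae (g := fun θ => ENNReal.ofReal (Real.log 2) *
    ENNReal.ofReal (-(Real.negMulLog (r θ).toReal / Real.log 2))) ?_) ?_
  · filter_upwards [hr'] with θ hθ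
    rw [Pi.mul_apply]
    set t := (r θ).toReal with ht
    have ht0 : 0 ≤ t := ENNReal.toReal_nonneg
    rw [← ENNReal.ofReal_toReal hθ.ne, ← ENNReal.ofReal_mul hlog2.le, ← ht,
      ← ENNReal.ofReal_mul ht0]
    rcases le_total t 1 with h1 | h1
    · simp [max_eq_right h1]
    · rw [max_eq_left h1]
      refine ENNReal.ofReal_le_ofReal (le_of_eq ?_)
      rw [Real.negMulLog]
      field_simp
  · rw [lintegral_const_mul' _ _ ENNReal.ofReal_ne_top]
    exact ENNReal.mul_lt_top ENNReal.ofReal_lt_top h.lt_top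

end PhaseDensity

theorem absolutelyContinuous_of_bot_lt_diffEntropy {E : Type*} [MeasureSpace E] {ν : Measure E}
    (h : ⊥ < diffEntropy ν) :
    ν ≪ volume ∧ ∫⁻ x, ENNReal.ofReal (-entropyIntegrand ν x) ≠ ⊤ := by
  unfold diffEntropy at h
  split_ifs at h with hac
  · refine ⟨hac, fun htop => ?_⟩
    rw [htop] at h
    simp at h
  · simp at h

/-! ### The forms `x ↦ |h ⬝ᵥ x| ^ 2` in real coordinates and the noise density -/

section Channel

variable {n : ℕ}

/-- The complex linear form `a ⬝ᵥ x` as a function of the real coordinates of `x`. -/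
noncomputable def realCoordForm (a : Fin n → ℂ) : (Fin n ⊕ Fin n → ℝ) →ₗ[ℝ] ℂ where
  toFun x := a ⬝ᵥ toComplexVec x
  map_add' x y := by
    rw [← dotProduct_add]
    congr 1
  map_smul' c x := by
    rw [RingHom.id_apply, ← dotProduct_smul]
    congr 1
    ext k
    apply Complex.ext <;> simp [toComplexVec]

open ComplexConjugate in
/-- The symmetric bilinear form polarizing `x ↦ |a ⬝ᵥ x|²`. -/
noncomputable def normSqForm (a : Fin n → ℂ) :
    (Fin n ⊕ Fin n → ℝ) →ₗ[ℝ] Module.Dual ℝ (Fin n ⊕ Fin n → ℝ) :=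
  LinearMap.mk₂ ℝ (fun x y => (conj (realCoordForm a x) * realCoordForm a y).re)
    (fun x x' y => by simp only [map_add, add_mul, Complex.add_re])
    (fun c x y => by simp; ring)
    (fun x y y' => by simp only [map_add, mul_add, Complex.add_re])
    (fun c x y => by simp; ring)

theorem normSqForm_comm (a : Fin n → ℂ) (x y : Fin n ⊕ Fin n → ℝ) :
    normSqForm a x y = normSqForm a y x := by
  simp [normSqForm]
  ring

theorem normSqForm_self (a : Fin n → ℂ) (x : Fin n ⊕ Fin n → ℝ) :
    normSqForm a x x = ‖realCoordForm a x‖ ^ 2 := by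
  rw [Complex.sq_norm, Complex.normSq_apply]
  simp [normSqForm]

theorem toComplexVec_surjective : Function.Surjective (toComplexVec (n := n)) := fun z =>
  ⟨Sum.elim (fun k => (z k).re) fun k => (z k).im, by ext k; simp [toComplexVec]⟩

theorem exists_mvPolynomial_norm_sq (a : Fin n → ℂ) :
    ∃ p : MvPolynomial (Fin n ⊕ Fin n) ℝ,
      ∀ x, MvPolynomial.eval x p = ‖realCoordForm a x‖ ^ 2 := by
  refine ⟨(∑ k, (MvPolynomial.C (a k).re * MvPolynomial.X (.inl k) -
      MvPolynomial.C (a k).im * MvPolynomial.X (.inr k))) ^ 2 +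
    (∑ k, (MvPolynomial.C (a k).re * MvPolynomial.X (.inr k) +
      MvPolynomial.C (a k).im * MvPolynomial.X (.inl k))) ^ 2, fun x => ?_⟩
  rw [Complex.sq_norm, Complex.normSq_apply]
  simp [realCoordForm, dotProduct, toComplexVec, pow_two]

variable {v : ℝ≥0}

open ComplexConjugate ComplexOrder in
theorem exists_realCoordForm_ne_zero {a : Fin n → ℂ} (ha : a ≠ 0) : ∃ x, realCoordForm a x ≠ 0 := by
  obtain ⟨x, hx⟩ := toComplexVec_surjective fun k => conj (a k)
  refine ⟨x, fun h => ha ?_⟩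
  have h1 : a ⬝ᵥ star a = 0 := by
    change a ⬝ᵥ toComplexVec x = 0 at h
    rw [hx] at h
    exact h
  exact dotProduct_self_star_eq_zero.1 h1

theorem ae_realCoordForm_ne_zero (hv : v ≠ 0) {a : Fin n → ℂ} (ha : a ≠ 0) :
    ∀ᵐ x ∂(Measure.pi fun _ : Fin n ⊕ Fin n => gaussianReal 0 v), realCoordForm a x ≠ 0 := by
  obtain ⟨p, hp⟩ := exists_mvPolynomial_norm_sq a
  obtain ⟨x₀, hx₀⟩ := exists_realCoordForm_ne_zero ha
  have hp0 : p ≠ 0 := by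
    rintro rfl
    have := hp x₀
    exact hx₀ (by simpa using this.symm)
  filter_upwards [ae_mvPolynomial_ne_zero hv hp0] with x hx h
  exact hx (by rw [hp, h]; simp)

theorem integrable_log_norm_realCoordForm (hv : v ≠ 0) {a : Fin n → ℂ} (ha : a ≠ 0) :
    Integrable (fun x => Real.log ‖realCoordForm a x‖)
      (Measure.pi fun _ : Fin n ⊕ Fin n => gaussianReal 0 v) := by
  obtain ⟨p, hp⟩ := exists_mvPolynomial_norm_sq a
  obtain ⟨x₀, hx₀⟩ := exists_realCoordForm_ne_zero ha
  have hp0 : p ≠ 0 := by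
    rintro rfl
    have := hp x₀
    exact hx₀ (by simpa using this.symm)
  refine ((integrable_log_mvPolynomial hv hp0).const_mul (1 / 2)).congr (.of_forall fun x => ?_)
  simp only
  rw [hp, abs_of_nonneg (by positivity), Real.log_pow]
  push_cast
  ring

theorem integrable_log_one_add_norm_sq (hv : v ≠ 0) (a : Fin n → ℂ) :
    Integrable (fun x => Real.log (1 + ‖realCoordForm a x‖ ^ 2))
      (Measure.pi fun _ : Fin n ⊕ Fin n => gaussianReal 0 v) := by
  obtain ⟨p, hp⟩ := exists_mvPolynomial_norm_sq a
  have hp0 : 1 + p ≠ 0 := by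
    intro h
    have := congrArg (MvPolynomial.eval 0) h
    rw [map_add, hp] at this
    simp at this
  refine (integrable_log_mvPolynomial hv hp0).congr (.of_forall fun x => ?_)
  simp only
  rw [map_add, hp, map_one, abs_of_nonneg (by positivity)]

open ComplexConjugate ComplexOrder in
theorem FullSpark.exists_linearIndependent_normSqForm {m : ℕ} (hn : 1 ≤ n) (hm : m ≤ 2 * n - 1)
    {h : Fin m → Fin n → ℂ} (hh : FullSpark h) :
    ∃ x₀, LinearIndependent ℝ fun i => normSqForm (h i) x₀ := by
  obtain ⟨x, hx⟩ := hh.exists_conj_mul_linearIndependent hn hm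
  obtain ⟨x₀, rfl⟩ := toComplexVec_surjective x
  refine ⟨x₀, Fintype.linearIndependent_iff.2 fun t ht i => congrFun (hx t ?_) i⟩
  set c : Fin n → ℂ := ∑ i, ((t i : ℂ) * conj (h i ⬝ᵥ toComplexVec x₀)) • h i with hc
  -- a relation between the functionals says that `re (c ⬝ᵥ y) = 0` for all `y`, so that `c = 0`
  have h1 : ∀ y, (c ⬝ᵥ toComplexVec y).re = 0 := by
    intro y
    have h2 := LinearMap.congr_fun ht y
    rw [LinearMap.sum_apply, LinearMap.zero_apply] at h2
    rw [← h2, hc, sum_dotProduct, Complex.re_sum]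
    refine Finset.sum_congr rfl fun i _ => ?_
    rw [smul_dotProduct, smul_eq_mul, mul_assoc, Complex.re_ofReal_mul]
    rfl
  obtain ⟨y, hy⟩ := toComplexVec_surjective (star c)
  have h2 := h1 y
  rw [hy] at h2
  have h3 : c ⬝ᵥ star c = ((∑ k, Complex.normSq (c k) : ℝ) : ℂ) := by
    push_cast
    exact Finset.sum_congr rfl fun k _ => Complex.mul_conj (c k)
  rw [h3, Complex.ofReal_re] at h2
  refine dotProduct_self_star_eq_zero.1 ?_
  rw [h3, h2, Complex.ofReal_zero]

/-- The noise density `φ` of `CN(0, I)`. -/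
noncomputable def noiseDensity (n : ℕ) (z : Fin n → ℂ) : ℝ :=
  ∏ i, (Real.pi⁻¹ * Real.exp (-‖z i‖ ^ 2))

theorem measurable_noiseDensity : Measurable (noiseDensity n) := by
  unfold noiseDensity
  fun_prop

theorem noiseDensity_nonneg (z : Fin n → ℂ) : 0 ≤ noiseDensity n z :=
  Finset.prod_nonneg fun i _ => by positivity

theorem inv_pi_mul_exp_le (z : ℂ) : Real.pi⁻¹ * Real.exp (-‖z‖ ^ 2) ≤ Real.exp (-‖z‖ ^ 2) :=
  mul_le_of_le_one_left (Real.exp_pos _).le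
    (inv_le_one_of_one_le₀ (by linarith [Real.pi_gt_three]))

theorem noiseDensity_le_one (z : Fin n → ℂ) : noiseDensity n z ≤ 1 :=
  Finset.prod_le_one (fun i _ => by positivity) fun i _ =>
    (inv_pi_mul_exp_le _).trans (Real.exp_le_one_iff.2 (by simp))

theorem complexGaussianVec_one_eq_noiseDensity (n : ℕ) :
    complexGaussianVec n 1 = (volume : Measure (Fin n → ℂ)).withDensity fun z =>
      ENNReal.ofReal (noiseDensity n z) := by
  rw [complexGaussianVec_one_eq_withDensity]
  congr 1
  funext z
  rw [noiseDensity, ENNReal.ofReal_prod_of_nonneg fun i _ => by positivity]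

theorem lintegral_noiseDensity (n : ℕ) : ∫⁻ z, ENNReal.ofReal (noiseDensity n z) = 1 := by
  rw [← setLIntegral_univ, ← withDensity_apply _ MeasurableSet.univ,
    ← complexGaussianVec_one_eq_noiseDensity, measure_univ]

/-- Averaging the noise density over independent uniform phases of a signal `a`: every coordinate
contributes a factor `1 / |a i|`, concentrated around the circle of radius `|a i|`. -/
theorem prod_norm_mul_lintegral_noiseDensity_le (a y : Fin n → ℂ) :
    (∏ i, ENNReal.ofReal ‖a i‖) * ∫⁻ θ in Set.univ.pi fun _ => Set.Ico 0 (2 * Real.pi),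
        ENNReal.ofReal (noiseDensity n (y - fun i => Complex.exp ((θ i : ℂ) * Complex.I) * a i)) ≤
      ∏ i, ENNReal.ofReal (44 * Real.exp (-(‖a i‖ - ‖y i‖) ^ 2 / 2)) := by
  have h1 : ∫⁻ θ in Set.univ.pi fun _ => Set.Ico 0 (2 * Real.pi),
      ENNReal.ofReal (noiseDensity n (y - fun i => Complex.exp ((θ i : ℂ) * Complex.I) * a i)) ≤
      ∏ i, ∫⁻ t in Set.Ico 0 (2 * Real.pi),
        ENNReal.ofReal (Real.exp (-‖y i - Complex.exp (t * Complex.I) * a i‖ ^ 2)) := by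
    rw [volume_pi, Measure.restrict_pi_pi, ← lintegral_pi_prod
      (fun _ : Fin n => (volume : Measure ℝ).restrict (Set.Ico 0 (2 * Real.pi)))
      (f := fun i t => ENNReal.ofReal (Real.exp (-‖y i - Complex.exp (t * Complex.I) * a i‖ ^ 2)))
      fun i => by fun_prop]
    refine lintegral_mono fun θ => ?_
    rw [noiseDensity, ENNReal.ofReal_prod_of_nonneg fun i _ => by positivity]
    exact Finset.prod_le_prod' fun i _ => ENNReal.ofReal_le_ofReal (inv_pi_mul_exp_le _)
  calc _ ≤ (∏ i, ENNReal.ofReal ‖a i‖) * ∏ i, ∫⁻ t in Set.Ico 0 (2 * Real.pi),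
        ENNReal.ofReal (Real.exp (-‖y i - Complex.exp (t * Complex.I) * a i‖ ^ 2)) := by gcongr
    _ ≤ _ := by
        rw [← Finset.prod_mul_distrib]
        exact Finset.prod_le_prod' fun i _ => norm_mul_lintegral_phase_le (a i) (y i)

end Channel

/-! ### The law of the channel output -/

section Law

variable {nr nt : ℕ}

theorem phaseNoiseOutput_apply (H : Matrix (Fin nr) (Fin nt) ℂ) (θR : Fin nr → ℝ)
    (θT : Fin nt → ℝ) (x : Fin nt → ℂ) (z : Fin nr → ℂ) :
    phaseNoiseOutput H θR θT x z = (fun i => Complex.exp ((θR i : ℂ) * Complex.I) *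
      (H i ⬝ᵥ fun k => Complex.exp ((θT k : ℂ) * Complex.I) * x k)) + z := by
  ext i
  simp only [phaseNoiseOutput, Pi.add_apply, Matrix.mulVec, dotProduct, Finset.mul_sum]
  congr 1
  refine Finset.sum_congr rfl fun k _ => ?_
  simp only [Matrix.hadamard_apply, Matrix.of_apply]
  push_cast
  rw [add_mul, Complex.exp_add]
  ring

/-- The noiseless output, with the transmit phase noise absorbed into the isotropic input, which
is written in normalized real coordinates. -/
noncomputable def rotatedSignal (H : Matrix (Fin nr) (Fin nt) ℂ) (P : ℝ)
    (q : (Fin nr → ℝ) × (Fin nt ⊕ Fin nt → ℝ)) : Fin nr → ℂ :=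
  fun i => Complex.exp ((q.1 i : ℂ) * Complex.I) * ((√P : ℂ) * realCoordForm (H i) q.2)

theorem measurable_realCoordForm (a : Fin nt → ℂ) : Measurable (realCoordForm a) :=
  (LinearMap.continuous_of_finiteDimensional _).measurable

theorem measurable_rotatedSignal (H : Matrix (Fin nr) (Fin nt) ℂ) (P : ℝ) :
    Measurable (rotatedSignal H P) := by
  refine measurable_pi_iff.2 fun i => ?_
  have h : Measurable fun q : (Fin nr → ℝ) × (Fin nt ⊕ Fin nt → ℝ) => realCoordForm (H i) q.2 :=
    (measurable_realCoordForm (H i)).comp measurable_snd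
  unfold rotatedSignal
  fun_prop

/-- The law of the channel output. The input law is invariant under the transmit phase rotations,
so the output law depends on the phase noise only through the law of the receive part. -/
theorem map_phaseNoiseOutput_eq (hnt : 1 ≤ nt) (H : Matrix (Fin nr) (Fin nt) ℂ)
    {Ω : Type*} [MeasurableSpace Ω] {μ : Measure Ω} [IsProbabilityMeasure μ]
    {ΘR : Ω → Fin nr → ℝ} {ΘT : Ω → Fin nt → ℝ} (hR : Measurable ΘR) (hT : Measurable ΘT)
    {P : ℝ} (hP : 0 < P) {X : Ω → Fin nt → ℂ} {Z : Ω → Fin nr → ℂ}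
    (hX : HasLaw X (complexGaussianVec nt (P / nt).toNNReal) μ)
    (hZ : HasLaw Z (complexGaussianVec nr 1) μ)
    (hΘZ : IndepFun (fun ω => (ΘR ω, ΘT ω)) Z μ)
    (hind : IndepFun X (fun ω => ((ΘR ω, ΘT ω), Z ω)) μ) :
    μ.map (fun ω => phaseNoiseOutput H (ΘR ω) (ΘT ω) (X ω) (Z ω)) =
      (((μ.map ΘR).prod (Measure.pi fun _ : Fin nt ⊕ Fin nt =>
        gaussianReal 0 (1 / (2 * nt) : ℝ≥0))).prod (complexGaussianVec nr 1)).map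
        (fun q => rotatedSignal H P q.1 + q.2) := by
  have hnt0 : (0 : ℝ) < nt := by exact_mod_cast hnt
  set v := (P / nt).toNNReal with hv
  have hvc : (v : ℝ) = P / nt := Real.coe_toNNReal _ (by positivity)
  have hv0 : v ≠ 0 := by
    rw [← NNReal.coe_ne_zero, hvc]; positivity
  set γX := complexGaussianVec nt v
  set γZ := complexGaussianVec nr 1
  set Θ : Ω → (Fin nr → ℝ) × (Fin nt → ℝ) := fun ω => (ΘR ω, ΘT ω)
  have hΘ : Measurable Θ := hR.prodMk hT
  set lam := μ.map Θ
  have : IsProbabilityMeasure lam := Measure.isProbabilityMeasure_map hΘ.aemeasurable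
  have : IsProbabilityMeasure (μ.map ΘR) := Measure.isProbabilityMeasure_map hR.aemeasurable
  -- joint law of the inputs
  have hXm := hX.aemeasurable
  have hZm := hZ.aemeasurable
  have hj : μ.map (fun ω => (X ω, (Θ ω, Z ω))) = γX.prod (lam.prod γZ) := by
    rw [(indepFun_iff_map_prod_eq_prod_map_map hXm (hΘ.aemeasurable.prodMk hZm)).1 hind, hX.map_eq,
      (indepFun_iff_map_prod_eq_prod_map_map hΘ.aemeasurable hZm).1 hΘZ, hZ.map_eq]
  let g₀ : ((Fin nr → ℝ) × (Fin nt → ℂ)) × (Fin nr → ℂ) → Fin nr → ℂ := fun q =>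
    (fun i => Complex.exp ((q.1.1 i : ℂ) * Complex.I) * (H i ⬝ᵥ q.1.2)) + q.2
  have hg₀ : Measurable g₀ := by
    simp only [g₀, dotProduct]
    fun_prop
  -- rearrangement `(x, (θ, z)) ↦ ((θ, x), z)`
  have hr1 : MeasurePreserving (fun q : (Fin nt → ℂ) × (((Fin nr → ℝ) × (Fin nt → ℝ)) ×
      (Fin nr → ℂ)) => ((q.2.1, q.1), q.2.2)) (γX.prod (lam.prod γZ)) ((lam.prod γX).prod γZ) := by
    have h1 := (measurePreserving_prodAssoc lam γX γZ).symm
    have h2 := (MeasurePreserving.id lam).prod (Measure.measurePreserving_swap (μ := γZ) (ν := γX))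
    have h3 := measurePreserving_prodAssoc lam γZ γX
    have h4 := Measure.measurePreserving_swap (μ := γX) (ν := lam.prod γZ)
    exact h1.comp (h2.comp (h3.comp h4))
  have hsk : MeasurePreserving (fun q : ((Fin nr → ℝ) × (Fin nt → ℝ)) × (Fin nt → ℂ) =>
      (q.1.1, fun k => Complex.exp ((q.1.2 k : ℂ) * Complex.I) * q.2 k)) (lam.prod γX)
      ((μ.map ΘR).prod γX) := by
    have hf : MeasurePreserving Prod.fst lam (μ.map ΘR) :=
      ⟨measurable_fst, Measure.map_map measurable_fst hΘ⟩
    refine hf.skew_product (g := fun (θ : (Fin nr → ℝ) × (Fin nt → ℝ))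
      (x : Fin nt → ℂ) k => Complex.exp ((θ.2 k : ℂ) * Complex.I) * x k) ?_
      (.of_forall fun θ => map_phase_mul_complexGaussianVec hv0 θ.2)
    simp only [Function.uncurry_def]
    fun_prop
  have hS : MeasurePreserving (fun x : Fin nt ⊕ Fin nt → ℝ => (√P : ℂ) • toComplexVec x)
      (Measure.pi fun _ => gaussianReal 0 (1 / (2 * nt) : ℝ≥0)) γX := by
    refine measurePreserving_smul_toComplexVec hP.le ?_
    rw [hvc]
    push_cast
    field_simp
  have e1 : (fun ω => phaseNoiseOutput H (ΘR ω) (ΘT ω) (X ω) (Z ω)) =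
      g₀ ∘ (Prod.map (fun q : ((Fin nr → ℝ) × (Fin nt → ℝ)) × (Fin nt → ℂ) =>
        (q.1.1, fun k => Complex.exp ((q.1.2 k : ℂ) * Complex.I) * q.2 k)) id) ∘
        (fun q : (Fin nt → ℂ) × (((Fin nr → ℝ) × (Fin nt → ℝ)) × (Fin nr → ℂ)) =>
          ((q.2.1, q.1), q.2.2)) ∘ fun ω => (X ω, (Θ ω, Z ω)) := by
    funext ω
    rw [phaseNoiseOutput_apply]
    rfl
  have e2 : (fun q : ((Fin nr → ℝ) × (Fin nt ⊕ Fin nt → ℝ)) × (Fin nr → ℂ) =>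
      rotatedSignal H P q.1 + q.2) =
      g₀ ∘ Prod.map (Prod.map id fun x : Fin nt ⊕ Fin nt → ℝ => (√P : ℂ) • toComplexVec x) id := by
    funext q
    simp only [g₀, Function.comp_apply]
    congr 1
    funext i
    change _ = Complex.exp _ * (H i ⬝ᵥ ((√P : ℂ) • toComplexVec q.1.2))
    rw [dotProduct_smul]
    rfl
  have hA := (hsk.prod (MeasurePreserving.id γZ)).comp hr1
  have hB := ((MeasurePreserving.id (μ.map ΘR)).prod hS).prod (MeasurePreserving.id γZ)
  have hYm : AEMeasurable (fun ω => (X ω, (Θ ω, Z ω))) μ := hXm.prodMk (hΘ.aemeasurable.prodMk hZm)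
  rw [e1, e2, ← Measure.map_map hg₀ hB.measurable, hB.map_eq, ← Function.comp_assoc,
    ← Function.comp_assoc, ← AEMeasurable.map_map_of_aemeasurable
      (by exact ((hg₀.comp (hsk.prod (MeasurePreserving.id γZ)).measurable).comp
        hr1.measurable).aemeasurable) hYm, hj, Function.comp_assoc,
    ← Measure.map_map hg₀ hA.measurable, hA.map_eq]

end Law

/-! ### The weight of the channel -/

section Weight

variable {nr nt m : ℕ}

/-- Pointwise form of the output bound: once the phases are averaged out, the weight
`∏ |ℓ i|` turns the phase average into a product of functions of the quadratic forms
`|ℓ j| ^ 2`, of which only those with index in `Fin m` are kept. -/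
theorem prod_norm_mul_lintegral_noiseDensity_rotatedSignal_le (H : Matrix (Fin nr) (Fin nt) ℂ)
    (hm : m ≤ nr) {P : ℝ} (hP : 0 < P) (y : Fin nr → ℂ) (x : Fin nt ⊕ Fin nt → ℝ) :
    ENNReal.ofReal ((∏ i, ‖realCoordForm (H i) x‖) *
        ∏ j : Fin m, (1 + ‖realCoordForm (H (Fin.castLE hm j)) x‖ ^ 2)⁻¹) *
      ∫⁻ θ in Set.univ.pi fun _ => Set.Ico 0 (2 * Real.pi),
        ENNReal.ofReal (noiseDensity nr (y - rotatedSignal H P (θ, x))) ≤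
      ENNReal.ofReal (P ^ (-(nr / 2 : ℝ))) * 44 ^ nr * ∏ j : Fin m,
        (Set.Ici 0).indicator (fun s => ENNReal.ofReal ((1 + s)⁻¹ *
          Real.exp (-(√P * √s - ‖y (Fin.castLE hm j)‖) ^ 2 / 2)))
          (normSqForm (H (Fin.castLE hm j)) x x) := by
  set r : Fin nr → ℝ := fun i => ‖realCoordForm (H i) x‖ with hr
  set J := ∫⁻ θ in Set.univ.pi fun _ => Set.Ico 0 (2 * Real.pi),
        ENNReal.ofReal (noiseDensity nr (y - rotatedSignal H P (θ, x))) with hJ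
  set E : Fin nr → ℝ := fun i => Real.exp (-(√P * r i - ‖y i‖) ^ 2 / 2) with hE
  have hsP : 0 < √P := Real.sqrt_pos.2 hP
  have hPow : P ^ (-(nr / 2 : ℝ)) * √P ^ nr = 1 := by
    rw [Real.sqrt_eq_rpow, ← Real.rpow_natCast, ← Real.rpow_mul hP.le, ← Real.rpow_add hP]
    ring_nf
    simp
  have h1 : (∏ i, ENNReal.ofReal (r i)) * J ≤
      ENNReal.ofReal (P ^ (-(nr / 2 : ℝ))) * 44 ^ nr * ∏ j : Fin m,
        ENNReal.ofReal (E (Fin.castLE hm j)) := by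
    have h2 := prod_norm_mul_lintegral_noiseDensity_le
      (fun i => (√P : ℂ) * realCoordForm (H i) x) y
    have h3 : ∀ i, ‖(√P : ℂ) * realCoordForm (H i) x‖ = √P * r i := fun i => by
      rw [norm_mul, Complex.norm_real, Real.norm_of_nonneg hsP.le]
    simp only [h3] at h2
    have h4 : ∏ i, ENNReal.ofReal (r i) =
        ENNReal.ofReal (P ^ (-(nr / 2 : ℝ))) * ∏ i, ENNReal.ofReal (√P * r i) := by
      rw [← ENNReal.ofReal_prod_of_nonneg fun i _ => norm_nonneg _,
        ← ENNReal.ofReal_prod_of_nonneg fun i _ => mul_nonneg hsP.le (norm_nonneg _),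
        ← ENNReal.ofReal_mul (by positivity), Finset.prod_mul_distrib, Finset.prod_const,
        Finset.card_univ, Fintype.card_fin, ← mul_assoc, hPow, one_mul]
    rw [h4, mul_assoc, mul_assoc]
    refine mul_le_mul_right (h2.trans ?_) _
    simp only [ENNReal.ofReal_mul (show (0 : ℝ) ≤ 44 by norm_num)]
    rw [Finset.prod_mul_distrib, Finset.prod_const, Finset.card_univ, Fintype.card_fin]
    norm_num
    refine mul_le_mul_right ?_ _
    refine le_trans ?_
      (Finset.prod_map Finset.univ (Fin.castLEEmb hm) fun i => ENNReal.ofReal (E i)).le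
    refine Finset.prod_le_prod_of_subset_of_le_one' (Finset.subset_univ _) fun i _ _ => ?_
    refine ENNReal.ofReal_le_one.2 (Real.exp_le_one_iff.2 ?_)
    nlinarith [sq_nonneg (√P * r i - ‖y i‖)]
  rw [ENNReal.ofReal_mul (Finset.prod_nonneg fun i _ => norm_nonneg _),
    ENNReal.ofReal_prod_of_nonneg fun i _ => norm_nonneg _,
    ENNReal.ofReal_prod_of_nonneg fun i _ => by positivity, mul_right_comm]
  refine (mul_le_mul_left h1 _).trans (le_of_eq ?_)
  rw [mul_assoc, ← Finset.prod_mul_distrib]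
  congr 1
  refine Finset.prod_congr rfl fun j _ => ?_
  rw [normSqForm_self, Set.indicator_of_mem (Set.mem_Ici.2 (sq_nonneg _)),
    Real.sqrt_sq (norm_nonneg _), ← ENNReal.ofReal_mul (by positivity), mul_comm]

/-- A log-integrable weight in the input for which the weighted output density, with uniform
receive phases, is of order `P ^ (-(nr + m) / 2)`, uniformly in the output. -/
theorem exists_channel_weight {H : Matrix (Fin nr) (Fin nt) ℂ} (hH : FullSpark H) (hnt : 1 ≤ nt)
    (hm0 : 1 ≤ m) (hmr : m ≤ nr) (hmt : m ≤ 2 * nt - 1) {v : ℝ≥0} (hv : v ≠ 0) :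
    ∃ (w : (Fin nt ⊕ Fin nt → ℝ) → ℝ) (C : ℝ), Measurable w ∧ 0 < C ∧
      (∀ᵐ x ∂(Measure.pi fun _ => gaussianReal 0 v), 0 < w x) ∧
      Integrable (fun x => Real.log (w x)) (Measure.pi fun _ => gaussianReal 0 v) ∧
      ∀ P : ℝ, 0 < P → ∀ y : Fin nr → ℂ,
        ∫⁻ x, ENNReal.ofReal (w x) * (∫⁻ θ in Set.univ.pi fun _ => Set.Ico 0 (2 * Real.pi),
          ENNReal.ofReal (noiseDensity nr (y - rotatedSignal H P (θ, x))))
          ∂(Measure.pi fun _ => gaussianReal 0 v) ≤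
        ENNReal.ofReal (C * P ^ (-((nr + m : ℝ) / 2))) := by
  have : Nonempty (Fin m) := ⟨⟨0, hm0⟩⟩
  have hh := hH.comp (Fin.castLE_injective hmr)
  obtain ⟨x₀, hx₀⟩ := hh.exists_linearIndependent_normSqForm hnt hmt
  obtain ⟨w₀, C₀, hw₀, hw₀pos, hw₀log, hC₀, hw₀le⟩ :=
    exists_weight_quadratic hv _ (fun i x y => normSqForm_comm _ x y) hx₀
  have hHi : ∀ i, H i ≠ 0 := fun i =>
    (hH {i} (by simpa using hnt)).ne_zero (by simp)
  have hne : ∀ᵐ x ∂(Measure.pi fun _ : Fin nt ⊕ Fin nt => gaussianReal 0 v),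
      ∀ i, realCoordForm (H i) x ≠ 0 :=
    ae_all_iff.2 fun i => ae_realCoordForm_ne_zero hv (hHi i)
  set u : (Fin nt ⊕ Fin nt → ℝ) → ℝ := fun x => (∏ i, ‖realCoordForm (H i) x‖) *
    ∏ j : Fin m, (1 + ‖realCoordForm (H (Fin.castLE hmr j)) x‖ ^ 2)⁻¹ with hu
  have hum : Measurable u := by
    have := fun i => measurable_realCoordForm (H i)
    fun_prop
  refine ⟨fun x => w₀ x * u x, 44 ^ nr * (C₀.toReal + 1) * √(2 * Real.pi) ^ m, hw₀.mul hum,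
    by positivity, ?_, ?_, fun P hP y => ?_⟩
  · filter_upwards [hw₀pos, hne] with x h1 h2
    exact mul_pos h1 (mul_pos (Finset.prod_pos fun i _ => norm_pos_iff.2 (h2 i))
      (Finset.prod_pos fun j _ => by positivity))
  · refine ((hw₀log.add (integrable_finsetSum Finset.univ fun i _ =>
      integrable_log_norm_realCoordForm hv (hHi i))).sub
      (integrable_finsetSum Finset.univ fun j _ =>
        integrable_log_one_add_norm_sq hv (H (Fin.castLE hmr j)))).congr ?_
    filter_upwards [hw₀pos, hne] with x h1 h2
    have h3 : ∏ i, ‖realCoordForm (H i) x‖ ≠ 0 :=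
      Finset.prod_ne_zero_iff.2 fun i _ => norm_ne_zero_iff.2 (h2 i)
    have h4 : ∏ j : Fin m, (1 + ‖realCoordForm (H (Fin.castLE hmr j)) x‖ ^ 2)⁻¹ ≠ 0 :=
      Finset.prod_ne_zero_iff.2 fun j _ => by positivity
    simp only [hu, Pi.sub_apply, Pi.add_apply]
    rw [Real.log_mul h1.ne' (mul_ne_zero h3 h4), Real.log_mul h3 h4,
      Real.log_prod fun i _ => norm_ne_zero_iff.2 (h2 i),
      Real.log_prod fun j _ => by positivity]
    simp only [Real.log_inv, Finset.sum_neg_distrib]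
    ring
  · set ψ : Fin m → ℝ → ℝ≥0∞ := fun j => (Set.Ici 0).indicator fun s => ENNReal.ofReal
      ((1 + s)⁻¹ * Real.exp (-(√P * √s - ‖y (Fin.castLE hmr j)‖) ^ 2 / 2)) with hψ
    have hψm : ∀ j, Measurable (ψ j) := fun j =>
      Measurable.indicator (by fun_prop) measurableSet_Ici
    set K : ℝ≥0∞ := ENNReal.ofReal (P ^ (-(nr / 2 : ℝ))) * 44 ^ nr with hK
    have hKtop : K ≠ ⊤ := ENNReal.mul_ne_top ENNReal.ofReal_ne_top (by simp)
    calc _ ≤ ∫⁻ x, K * (ENNReal.ofReal (w₀ x) *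
          ∏ j, ψ j (normSqForm ((H ∘ Fin.castLE hmr) j) x x))
          ∂(Measure.pi fun _ : Fin nt ⊕ Fin nt => gaussianReal 0 v) := by
          refine lintegral_mono fun x => ?_
          dsimp only
          have h1 := prod_norm_mul_lintegral_noiseDensity_rotatedSignal_le H hmr hP y x
          have h2 : 0 ≤ u x := mul_nonneg (Finset.prod_nonneg fun i _ => norm_nonneg _)
            (Finset.prod_nonneg fun j _ => by positivity)
          rw [ENNReal.ofReal_mul' h2, mul_assoc, mul_left_comm K]
          exact mul_le_mul_right h1 _
      _ ≤ K * (C₀ * ∏ j, ∫⁻ s, ψ j s) := by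
          rw [lintegral_const_mul' _ _ hKtop]
          exact mul_le_mul_right (hw₀le ψ hψm) _
      _ ≤ K * (C₀ * ∏ _j : Fin m, ENNReal.ofReal (√(2 * Real.pi) * P ^ (-(1 / 2 : ℝ)))) := by
          gcongr with j
          exact lintegral_Ici_sqrt_le hP _
      _ ≤ K * (ENNReal.ofReal (C₀.toReal + 1) *
            ENNReal.ofReal ((√(2 * Real.pi) * P ^ (-(1 / 2 : ℝ))) ^ m)) := by
          rw [Finset.prod_const, Finset.card_univ, Fintype.card_fin,
            ← ENNReal.ofReal_pow (by positivity)]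
          gcongr
          exact (ENNReal.le_ofReal_iff_toReal_le hC₀ (by positivity)).2 (by linarith)
      _ = _ := by
          have h44 : (44 : ℝ≥0∞) ^ nr = ENNReal.ofReal (44 ^ nr) := by
            rw [ENNReal.ofReal_pow (by norm_num)]; norm_num
          rw [hK, h44, ← ENNReal.ofReal_mul (by positivity), ← ENNReal.ofReal_mul (by positivity),
            ← ENNReal.ofReal_mul (by positivity)]
          congr 1
          have hp : P ^ (-((nr + m : ℝ) / 2)) = P ^ (-(nr / 2 : ℝ)) * (P ^ (-(1 / 2 : ℝ))) ^ m := by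
            rw [← Real.rpow_natCast, ← Real.rpow_mul hP.le, ← Real.rpow_add hP]
            congr 1
            ring
          rw [hp, mul_pow]
          ring

end Weight

/-! ### The entropy bound -/

/-- The entropy bound for the output in terms of the law `ν` of the receive phase noise, with the
transmit phase noise already absorbed into the input. -/
theorem exists_le_diffEntropy_map_rotatedSignal {nr nt m : ℕ} {H : Matrix (Fin nr) (Fin nt) ℂ}
    (hH : FullSpark H) (hnt : 1 ≤ nt) (hm0 : 1 ≤ m) (hmr : m ≤ nr) (hmt : m ≤ 2 * nt - 1)
    {v : ℝ≥0} (hv : v ≠ 0) {ν : Measure (Fin nr → ℝ)} [IsProbabilityMeasure ν]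
    (hν : ∀ᵐ θ ∂ν, ∀ i, θ i ∈ Set.Ico 0 (2 * Real.pi)) (hent : ⊥ < diffEntropy ν) :
    ∃ c : ℝ, ∀ P : ℝ, 0 < P →
      (((nr + m : ℝ) / 2 * (Real.posLog P / Real.log 2) + c : ℝ) : EReal) ≤
        diffEntropy (((ν.prod (Measure.pi fun _ : Fin nt ⊕ Fin nt => gaussianReal 0 v)).prod
          (complexGaussianVec nr 1)).map fun q => rotatedSignal H P q.1 + q.2) := by
  obtain ⟨w, C, hw, hC, hwpos, hwlog, hle⟩ := exists_channel_weight hH hnt hm0 hmr hmt hv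
  obtain ⟨hac, hfin⟩ := absolutelyContinuous_of_bot_lt_diffEntropy hent
  set γ := Measure.pi fun _ : Fin nt ⊕ Fin nt => gaussianReal 0 v
  set ρ : (Fin nr → ℝ) → ℝ := fun θ => max (ν.rnDeriv volume θ).toReal 1 with hρ
  have hρm : Measurable ρ :=
    (Measure.measurable_rnDeriv ν volume).ennreal_toReal.max measurable_const
  have hρ0 : ∀ θ, 0 < ρ θ := fun θ => zero_lt_one.trans_le (le_max_right _ _)
  set wt : (Fin nr → ℝ) × (Fin nt ⊕ Fin nt → ℝ) → ℝ := fun q => w q.2 * (ρ q.1)⁻¹ with hwt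
  have hwtm : Measurable wt :=
    (hw.comp measurable_snd).mul (hρm.comp measurable_fst).inv
  have hpos2 : ∀ᵐ q ∂ν.prod γ, 0 < w q.2 := Measure.quasiMeasurePreserving_snd.ae hwpos
  have hwtpos : ∀ᵐ q ∂ν.prod γ, 0 < wt q := by
    filter_upwards [hpos2] with q hq
    exact mul_pos hq (inv_pos.2 (hρ0 _))
  have hwtlog : Integrable (fun q => Real.log (wt q)) (ν.prod γ) := by
    refine ((hwlog.comp_snd ν).sub ((integrable_log_max_rnDeriv hac hfin).comp_fst γ)).congr ?_
    filter_upwards [hpos2] with q hq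
    simp only [hwt, Pi.sub_apply]
    rw [Real.log_mul hq.ne' (inv_pos.2 (hρ0 _)).ne', Real.log_inv, sub_eq_add_neg]
  have hS : MeasurableSet (Set.univ.pi fun _ : Fin nr => Set.Ico (0 : ℝ) (2 * Real.pi)) :=
    .univ_pi fun _ => measurableSet_Ico
  have hνS : ∀ᵐ θ ∂ν, θ ∈ Set.univ.pi fun _ : Fin nr => Set.Ico (0 : ℝ) (2 * Real.pi) := by
    simpa [Set.mem_univ_pi] using hν
  have hbound : ∀ P : ℝ, 0 < P → ∀ y : Fin nr → ℂ,
      ∫⁻ q, ENNReal.ofReal (wt q * noiseDensity nr (y - rotatedSignal H P q)) ∂ν.prod γ ≤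
        ENNReal.ofReal (C * P ^ (-((nr + m : ℝ) / 2))) := by
    intro P hP y
    have hg : Measurable fun q : (Fin nr → ℝ) × (Fin nt ⊕ Fin nt → ℝ) =>
        ENNReal.ofReal (noiseDensity nr (y - rotatedSignal H P q)) :=
      (measurable_noiseDensity.comp
        (measurable_const.sub (measurable_rotatedSignal H P))).ennreal_ofReal
    have hm : Measurable fun q => ENNReal.ofReal (wt q * noiseDensity nr
        (y - rotatedSignal H P q)) :=
      (hwtm.mul (measurable_noiseDensity.comp
        (measurable_const.sub (measurable_rotatedSignal H P)))).ennreal_ofReal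
    rw [lintegral_prod_symm _ hm.aemeasurable]
    refine le_trans (lintegral_mono_ae ?_) (hle P hP y)
    filter_upwards [hwpos] with x hx
    calc _ = ENNReal.ofReal (w x) * ∫⁻ θ, ENNReal.ofReal (ρ θ)⁻¹ *
          ENNReal.ofReal (noiseDensity nr (y - rotatedSignal H P (θ, x))) ∂ν := by
          rw [← lintegral_const_mul' _ _ ENNReal.ofReal_ne_top]
          refine lintegral_congr fun θ => ?_
          rw [← ENNReal.ofReal_mul (inv_pos.2 (hρ0 _)).le, ← ENNReal.ofReal_mul hx.le, ← mul_assoc]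
      _ ≤ _ := mul_le_mul_right (lintegral_inv_max_rnDeriv_mul_le hac hS hνS
          (hg.comp measurable_prodMk_right)) _
  have hlog2 : 0 < Real.log 2 := Real.log_pos one_lt_two
  set I := ∫ q, Real.log (wt q) ∂ν.prod γ
  -- the minimum with `0` covers `P < 1`, where only nonnegativity of the entropy is used
  refine ⟨min 0 ((I - Real.log C) / Real.log 2), fun P hP => ?_⟩
  rw [complexGaussianVec_one_eq_noiseDensity]
  rcases lt_or_ge P 1 with h1 | h1
  · have h0 : Real.posLog P = 0 :=
      (Real.posLog_eq_zero_iff P).2 (by rw [abs_of_pos hP]; exact h1.le)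
    refine le_trans ?_ (zero_le_diffEntropy_map_add (measurable_rotatedSignal H P)
      measurable_noiseDensity noiseDensity_nonneg noiseDensity_le_one)
    rw [h0, zero_div, mul_zero, zero_add]
    exact_mod_cast min_le_left _ _
  · have h0 : Real.posLog P = Real.log P :=
      Real.posLog_eq_log (by rwa [abs_of_pos hP])
    refine le_trans ?_ (le_diffEntropy_map_add (measurable_rotatedSignal H P)
      measurable_noiseDensity noiseDensity_nonneg noiseDensity_le_one (lintegral_noiseDensity nr)
      hwtm hwtpos hwtlog (mul_pos hC (Real.rpow_pos_of_pos hP _)) (hbound P hP))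
    rw [h0, Real.log_mul hC.ne' (Real.rpow_pos_of_pos hP _).ne', Real.log_rpow hP]
    refine EReal.coe_le_coe_iff.2 ?_
    calc _ ≤ (nr + m : ℝ) / 2 * (Real.log P / Real.log 2) + (I - Real.log C) / Real.log 2 := by
          gcongr
          exact min_le_right _ _
      _ = _ := by ring

theorem mainTheorem4 (nr nt : ℕ) (hnr : 1 ≤ nr) (hnt : 1 ≤ nt) :
    HoldsForGeneric fun H : Matrix (Fin nr) (Fin nt) ℂ =>
      ∀ (Ω : Type*) [MeasurableSpace Ω] (μ : Measure Ω) [IsProbabilityMeasure μ]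
        (ΘR : Ω → Fin nr → ℝ) (ΘT : Ω → Fin nt → ℝ),
        Measurable ΘR → Measurable ΘT →
        (∀ᵐ ω ∂μ, ∀ i, ΘR ω i ∈ Set.Ico 0 (2 * Real.pi)) →
        ⊥ < diffEntropy (μ.map ΘR) →
        ∃ c : ℝ, ∀ P : ℝ, 0 < P → ∀ (X : Ω → Fin nt → ℂ) (Z : Ω → Fin nr → ℂ),
          HasLaw X (complexGaussianVec nt (P / nt).toNNReal) μ →
          HasLaw Z (complexGaussianVec nr 1) μ →
          IndepFun (fun ω => (ΘR ω, ΘT ω)) Z μ →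
          IndepFun X (fun ω => ((ΘR ω, ΘT ω), Z ω)) μ →
          ((((nr : ℝ) / 2 + 1 / 2 * min (nr : ℝ) (2 * (nt : ℝ) - 1)) *
              (Real.posLog P / Real.log 2) + c : ℝ) : EReal) ≤
            diffEntropy (μ.map fun ω => phaseNoiseOutput H (ΘR ω) (ΘT ω) (X ω) (Z ω)) := by
  obtain ⟨q, hq, hqH⟩ := holdsForGeneric_fullSpark nr nt
  refine ⟨q, hq, fun H hH => ?_⟩
  intro Ω _ μ _ ΘR ΘT hR hT hbox hent
  have : IsProbabilityMeasure (μ.map ΘR) := Measure.isProbabilityMeasure_map hR.aemeasurable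
  have hν : ∀ᵐ θ ∂μ.map ΘR, ∀ i, θ i ∈ Set.Ico 0 (2 * Real.pi) := by
    refine (ae_map_iff hR.aemeasurable ?_).2 hbox
    simp only [Set.ofPred_forall]
    exact .iInter fun i => measurable_pi_apply i measurableSet_Ico
  have hv : (1 / (2 * nt) : ℝ≥0) ≠ 0 := by
    have : (nt : ℝ≥0) ≠ 0 := by exact_mod_cast (by omega : nt ≠ 0)
    positivity
  obtain ⟨c, hc⟩ := exists_le_diffEntropy_map_rotatedSignal (m := min nr (2 * nt - 1)) (hqH H hH)
    hnt (by omega) (min_le_left _ _) (min_le_right _ _) hv hν hent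
  refine ⟨c, fun P hP X Z hX hZ hΘZ hind => ?_⟩
  rw [map_phaseNoiseOutput_eq hnt H hR hT hP hX hZ hΘZ hind]
  refine le_trans (le_of_eq ?_) (hc P hP)
  rw [Nat.cast_min, Nat.cast_sub (by omega), Nat.cast_mul, Nat.cast_ofNat, Nat.cast_one]
  congr 1
  ring
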